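/- Let $X=[0,1)$ with Lebesgue measure $\mu$, let $\mathbb D=\{i/2^n : n\ge 0,\ 0\le i\le 2^n-1\}$, and let $R=\{(x,\,x+r \bmod 1): x\in X,\ r\in\mathbb D\}\subseteq X\times X$. For measurable $E\subseteq R$ let $\nu(E)=\int_X |\{x : (x,y)\in E\}|\,d\mu(y)$ be the right counting measure, and let $H=L^2(R,\nu)$. Let $\Sigma_0$ be the set of bounded Borel functions $a\colon R\to\mathbb C$ whose support $E$ is band limited, that is, $\sup_{x,y\in X}\big(|\{z:(z,x)\in E\}|+|\{z:(y,z)\in E\}|\big)<\infty$. Each $a\in\Sigma_0$ gives a bounded operator $L_0(a)$ on $H$, $(L_0(a)\xi)(x,z)=\sum_{y\sim x}a(x,y)\,\xi(y,z)$ (convolution with the trivial cocycle $\mathbf 1$). Let $\mathcal M=\mathcal M(R,\mathbf 1)$ be the von Neumann algebra on $H$ generated by $\{L_0(a):a\in\Sigma_0\}$. Let $\chi_\Delta\in H$ be the characteristic function of the diagonal of $R$, let $s\colon\mathcal M\to H$, $s(T)=T\chi_\Delta$, be the (injective) symbol map, let $\Sigma(R,\mathbf 1)=s(\mathcal M)$,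 and let $L=s^{-1}\colon\Sigma(R,\mathbf 1)\to\mathcal M$. Write $\star$ for the pointwise product of ($\nu$-a.e. classes of) functions on $R$, and let $$\mathfrak S(R,\mathbf 1)=\{\varphi\in L^\infty(R,\nu) : \varphi\star a\in\Sigma(R,\mathbf 1)\ \text{for all } a\in\Sigma(R,\mathbf 1)\}$$ be the set of Schur multipliers. **Theorem.** $\Sigma(R,\mathbf 1)\subseteq\mathfrak S(R,\mathbf 1)$. Moreover, if $a,b\in\Sigma(R,\mathbf 1)$, then $a\star b\in\Sigma(R,\mathbf 1)$ and $\|L(a\star b)\|\le\|L(a)\|\,\|L(b)\|$, where the norms are operator norms on $H$. -/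

import Mathlib

open MeasureTheory
open scoped ENNReal

/-- A Feldman–Moore relation `(X, μ, R, σ)`: a standard Borel probability space `(X, μ)`, a countable
Borel equivalence relation `R` on `X` under which `μ` is quasi-invariant, and a normalised
`𝕋`-valued Borel 2-cocycle `σ` on `R`.  The cocycle is written as a function of three points of `X`;
only its values on triples of equivalent points matter. -/
structure FeldmanMoore (X : Type*) [MeasurableSpace X] where
  standardBorel : StandardBorelSpace X
  μ : Measure X
  isProb : IsProbabilityMeasure μ
  rel : X → X → Prop
  equivalence : Equivalence rel
  countable_class : ∀ x, {y | rel x y}.Countable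
  measurableSet_rel : MeasurableSet {p : X × X | rel p.1 p.2}
  quasiInvariant : ∀ α : Set X, MeasurableSet α → (μ α = 0 ↔ μ {y | ∃ x ∈ α, rel x y} = 0)
  σ : X → X → X → Circle
  measurable_cocycle : Measurable
    fun t : {t : X × X × X // rel t.1 t.2.1 ∧ rel t.2.1 t.2.2} => (σ t.1.1 t.1.2.1 t.1.2.2 : ℂ)
  cocycle : ∀ x y z w, rel x y → rel y z → rel z w →
    σ x y z * σ x z w = σ x y w * σ y z w
  normalised : ∀ x y z, rel x y → rel y z → (x = y ∨ y = z ∨ x = z) → σ x y z = 1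

namespace FeldmanMoore

noncomputable section

variable {X : Type*} [MeasurableSpace X] (R : FeldmanMoore X)

/-- The relation `R ⊆ X × X` as a measurable space, with the relative Borel structure. -/
abbrev Graph : Type _ := {p : X × X // R.rel p.1 p.2}

/-- The horizontal slice `E_y = {(z, y) : (z, y) ∈ E}`. -/
def hSlice (E : Set R.Graph) (y : X) : Set R.Graph := {p ∈ E | p.1.2 = y}

/-- The vertical slice `E^x = {(x, z) : (x, z) ∈ E}`. -/
def vSlice (E : Set R.Graph) (x : X) : Set R.Graph := {p ∈ E | p.1.1 = x}

/-- `𝔹(E) = sup_{x,y} (|E_x| + |E^y|)`. -/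
def bandwidth (E : Set R.Graph) : ℕ∞ :=
  ⨆ (x : X) (y : X), (R.hSlice E x).encard + (R.vSlice E y).encard

/-- Left finite functions: bounded Borel functions on `R` with band limited support. -/
def leftFinite : Set (R.Graph → ℂ) :=
  {a | Measurable a ∧ (∃ C : ℝ, ∀ p, ‖a p‖ ≤ C) ∧ R.bandwidth (Function.support a) < ⊤}

/-- The right counting measure `ν(E) = ∫ |E_y| dμ(y)`, as the mixture over `y` of the counting
measures on the horizontal slices of `R`. -/
def ν : Measure R.Graph :=
  R.μ.bind fun y => Measure.count.restrict (R.hSlice Set.univ y)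

/-- The Hilbert space `L²(R, ν)`. -/
abbrev H : Type _ := Lp ℂ 2 R.ν

/-- The twisted convolution `(a *_σ ξ)(x, z) = ∑_{y ∼ x} a(x, y) ξ(y, z) σ(x, y, z)`. -/
def conv (a ξ : R.Graph → ℂ) (p : R.Graph) : ℂ :=
  ∑' y : {y : X // R.rel p.1.1 y},
    a ⟨(p.1.1, y.1), y.2⟩ *
      ξ ⟨(y.1, p.1.2), R.equivalence.trans (R.equivalence.symm y.2) p.2⟩ *
      (R.σ p.1.1 y.1 p.1.2 : ℂ)

/-- `M₀(R, σ)`: the bounded operators on `L²(R, ν)` of left convolution by a left finite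
function. -/
def leftFiniteOperators : Set (R.H →L[ℂ] R.H) :=
  {T | ∃ a ∈ R.leftFinite, ∀ ξ : R.H, (T ξ : R.Graph → ℂ) =ᵐ[R.ν] R.conv a ξ}

end

end FeldmanMoore

/-- The von Neumann algebra generated by a set of bounded operators: the bicommutant of the set and
its adjoints. -/
noncomputable def vonNeumannGenerated {H : Type*} [NormedAddCommGroup H] [InnerProductSpace ℂ H]
    [CompleteSpace H] (S : Set (H →L[ℂ] H)) : VonNeumannAlgebra H where
  toStarSubalgebra := StarSubalgebra.centralizer ℂ (StarSubalgebra.centralizer ℂ S : Set (H →L[ℂ] H))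
  centralizer_centralizer' := by
    have h : ∀ s : Set (H →L[ℂ] H),
        (StarSubalgebra.centralizer ℂ s : Set (H →L[ℂ] H)) = Set.centralizer (s ∪ star s) :=
      fun s => StarSubalgebra.coe_centralizer ℂ s
    change Set.centralizer (Set.centralizer
      (StarSubalgebra.centralizer ℂ (StarSubalgebra.centralizer ℂ S : Set (H →L[ℂ] H)) :
        Set (H →L[ℂ] H))) =
        ((StarSubalgebra.centralizer ℂ (StarSubalgebra.centralizer ℂ S : Set (H →L[ℂ] H)) :
          StarSubalgebra ℂ (H →L[ℂ] H)) : Set (H →L[ℂ] H))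
    rw [h (StarSubalgebra.centralizer ℂ S : Set (H →L[ℂ] H)), Set.centralizer_centralizer_centralizer]

/-- `vonNeumannGenerated S` is the smallest von Neumann algebra containing `S`. -/
theorem mem_vonNeumannGenerated_iff {H : Type*} [NormedAddCommGroup H] [InnerProductSpace ℂ H]
    [CompleteSpace H] (S : Set (H →L[ℂ] H)) (T : H →L[ℂ] H) :
    T ∈ vonNeumannGenerated S ↔ ∀ N : VonNeumannAlgebra H, S ⊆ N → T ∈ N := by
  have h : ∀ s : Set (H →L[ℂ] H),
      (StarSubalgebra.centralizer ℂ s : Set (H →L[ℂ] H)) = Set.centralizer (s ∪ star s) :=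
    fun s => StarSubalgebra.coe_centralizer ℂ s
  have hs : star (StarSubalgebra.centralizer ℂ S : Set (H →L[ℂ] H)) =
      (StarSubalgebra.centralizer ℂ S : Set (H →L[ℂ] H)) := by
    ext x
    simp only [Set.mem_star, SetLike.mem_coe]
    exact ⟨fun hx => by simpa using star_mem hx, fun hx => star_mem hx⟩
  have hv : (vonNeumannGenerated S : Set (H →L[ℂ] H)) =
      Set.centralizer (Set.centralizer (S ∪ star S)) := by
    change ((StarSubalgebra.centralizer ℂ
      (StarSubalgebra.centralizer ℂ S : Set (H →L[ℂ] H)) : StarSubalgebra ℂ (H →L[ℂ] H)) :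
        Set (H →L[ℂ] H)) = _
    rw [h (StarSubalgebra.centralizer ℂ S : Set (H →L[ℂ] H)), hs, Set.union_self, h S]
  have hv' : T ∈ vonNeumannGenerated S ↔ T ∈ Set.centralizer (Set.centralizer (S ∪ star S)) := by
    rw [← hv]; rfl
  rw [hv']
  constructor
  · intro hT N hN
    have hN' : S ∪ star S ⊆ (N : Set (H →L[ℂ] H)) := by
      rintro x (hx | hx)
      · exact hN hx
      · have : star x ∈ N := hN hx
        simpa using star_mem this
    have := Set.centralizer_subset (Set.centralizer_subset hN') hT
    rw [N.centralizer_centralizer] at this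
    exact this
  · intro hT
    rw [← hv']
    refine hT _ fun x hx => ?_
    have : x ∈ Set.centralizer (Set.centralizer (S ∪ star S)) :=
      Set.subset_centralizer_centralizer (Or.inl hx)
    rw [← hv] at this
    exact this

namespace FeldmanMoore

noncomputable section

variable {X : Type*} [MeasurableSpace X] (R : FeldmanMoore X)

/-- The von Neumann algebra `M(R, σ)` of a Feldman–Moore relation. -/
def vN : VonNeumannAlgebra R.H := vonNeumannGenerated R.leftFiniteOperators

/-- The diagonal `Δ = {(x, x) : x ∈ X}` of `R`. -/
def diag : Set R.Graph := {p | p.1.1 = p.1.2}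

theorem measurableSet_diag : MeasurableSet R.diag := by
  have := R.standardBorel
  exact measurableSet_eq_fun (measurable_fst.comp measurable_subtype_coe)
    (measurable_snd.comp measurable_subtype_coe)

theorem ν_diag_ne_top : R.ν R.diag ≠ ∞ := by
  have := R.isProb
  have := R.standardBorel
  by_cases h : AEMeasurable (fun y => Measure.count.restrict (R.hSlice Set.univ y)) R.μ
  · rw [ν, Measure.bind_apply R.measurableSet_diag h]
    refine ((lintegral_mono (g := fun _ => 1) fun y => ?_).trans_lt (by simp)).ne
    change (Measure.count.restrict (R.hSlice Set.univ y)) R.diag ≤ 1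
    rw [Measure.restrict_apply R.measurableSet_diag]
    have hsub : R.diag ∩ R.hSlice Set.univ y ⊆ {⟨(y, y), R.equivalence.refl y⟩} := by
      rintro ⟨⟨x, z⟩, hp⟩ ⟨h1, -, h2⟩
      simp only [diag, Set.mem_ofPred_eq] at h1 h2
      simp [h1, h2]
    exact (measure_mono hsub).trans (by simp)
  · simp [ν, Measure.bind, Measure.map_of_not_aemeasurable h]

/-- `χ_Δ` as a vector of `L²(R, ν)`. -/
def χΔ : R.H := indicatorConstLp 2 R.measurableSet_diag R.ν_diag_ne_top 1

/-- The symbol map `s(T) = T χ_Δ`, with values in the classes of functions on `R` modulo equality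
`ν`-almost everywhere. -/
def symbol (T : R.vN) : R.Graph →ₘ[R.ν] ℂ := ((T : R.H →L[ℂ] R.H) R.χΔ : R.H)

/-- The symbol set `Σ(R, σ)`, the range of the symbol map. -/
def symbolSet : Set (R.Graph →ₘ[R.ν] ℂ) := Set.range R.symbol

/-- The inverse symbol map `L : Σ(R, σ) → M(R, σ)`: it sends a symbol `a` to the operator `T` with
`s(T) = a`, which is unique because the symbol map is injective. -/
def inverseSymbol : R.symbolSet → R.vN :=
  Function.surjInv (f := Set.rangeFactorization R.symbol) Set.rangeFactorization_surjective

/-- The Schur multipliers `𝔖(R, σ)`: the `φ ∈ L^∞(R, ν)` whose pointwise product with every symbol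
is again a symbol. -/
def schurMultipliers : Set (R.Graph →ₘ[R.ν] ℂ) :=
  {φ | φ ∈ Lp ℂ ∞ R.ν ∧ ∀ a ∈ R.symbolSet, φ * a ∈ R.symbolSet}

end

end FeldmanMoore

/-- The dyadic rationals `i / 2ⁿ` with `0 ≤ i ≤ 2ⁿ - 1`. -/
def unitDyadics : Set ℝ := {r | ∃ n i : ℕ, i < 2 ^ n ∧ r = (i : ℝ) / 2 ^ n}

/-- The orbit relation on `[0, 1)` of translation by dyadic rationals modulo 1. -/
def dyadicRel (x y : Set.Ico (0 : ℝ) 1) : Prop :=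
  ∃ r ∈ unitDyadics, (y : ℝ) = Int.fract ((x : ℝ) + r)

theorem dyadicRel_iff (x y : Set.Ico (0 : ℝ) 1) :
    dyadicRel x y ↔ ∃ (n : ℕ) (k : ℤ), (y : ℝ) - x = (k : ℝ) / 2 ^ n := by
  constructor
  · rintro ⟨r, ⟨n, i, -, rfl⟩, h⟩
    refine ⟨n, i - ⌊(x : ℝ) + (i : ℝ) / 2 ^ n⌋ * 2 ^ n, ?_⟩
    rw [h, Int.fract]
    push_cast
    field_simp
    ring
  · rintro ⟨n, k, h⟩
    have hx := x.2
    have hy := y.2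
    have h2 : (0 : ℝ) < 2 ^ n := by positivity
    have hk : (k : ℝ) = ((y : ℝ) - x) * 2 ^ n := by rw [h]; field_simp
    by_cases hk0 : 0 ≤ k
    · lift k to ℕ using hk0
      refine ⟨(k : ℝ) / 2 ^ n, ⟨n, k, ?_, rfl⟩, ?_⟩
      · have : (k : ℝ) < 2 ^ n := by
          push_cast at hk
          rw [hk]
          nlinarith [hx.1, hy.2]
        exact_mod_cast this
      · push_cast at h
        rw [← h, add_sub_cancel, Int.fract_eq_self.2 hy]
    · obtain ⟨m, hm⟩ : ∃ m : ℕ, (m : ℤ) = k + 2 ^ n := by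
        refine ⟨(k + 2 ^ n).toNat, Int.toNat_of_nonneg ?_⟩
        have : (0 : ℝ) ≤ (k : ℝ) + 2 ^ n := by
          rw [hk]
          nlinarith [hx.2, hy.1]
        exact_mod_cast this
      have hm' : (m : ℝ) = (k : ℝ) + 2 ^ n := by exact_mod_cast hm
      refine ⟨(m : ℝ) / 2 ^ n, ⟨n, m, ?_, rfl⟩, ?_⟩
      · have : (m : ℤ) < 2 ^ n := by omega
        exact_mod_cast this
      · have : (x : ℝ) + (m : ℝ) / 2 ^ n = (y : ℝ) + 1 := by
          rw [hm', add_div, ← h, div_self h2.ne']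
          ring
        rw [this, Int.fract_add_one, Int.fract_eq_self.2 hy]

theorem dyadicRel_equivalence : Equivalence dyadicRel where
  refl x := (dyadicRel_iff x x).2 ⟨0, 0, by simp⟩
  symm := fun {x y} h => by
    obtain ⟨n, k, h⟩ := (dyadicRel_iff x y).1 h
    refine (dyadicRel_iff y x).2 ⟨n, -k, ?_⟩
    push_cast
    rw [neg_div, ← h]
    ring
  trans := fun {x y z} h h' => by
    obtain ⟨n, k, h⟩ := (dyadicRel_iff x y).1 h
    obtain ⟨m, l, h'⟩ := (dyadicRel_iff y z).1 h'
    refine (dyadicRel_iff x z).2 ⟨n + m, k * 2 ^ m + l * 2 ^ n, ?_⟩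
    have : (z : ℝ) - x = (y - x) + (z - y) := by ring
    rw [this, h, h', pow_add]
    push_cast
    field_simp

/-- The dyadic relation on `X = [0, 1)`, with Lebesgue measure and the trivial cocycle `1`. -/
noncomputable def dyadicFeldmanMoore : FeldmanMoore (Set.Ico (0 : ℝ) 1) where
  standardBorel := measurableSet_Ico.standardBorel
  μ := Measure.comap Subtype.val volume
  isProb := ⟨by
    rw [comap_subtype_coe_apply measurableSet_Ico volume, Set.image_univ, Subtype.range_coe,
      Real.volume_Ico]
    simp⟩
  rel := dyadicRel
  equivalence := dyadicRel_equivalence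
  countable_class x := by
    have : {y | dyadicRel x y} ⊆ ⋃ (n : ℕ) (k : ℤ),
        {y : Set.Ico (0 : ℝ) 1 | (y : ℝ) - x = (k : ℝ) / 2 ^ n} := fun y hy => by
      simpa using (dyadicRel_iff x y).1 hy
    refine (Set.countable_iUnion fun n => Set.countable_iUnion fun k => ?_).mono this
    refine Set.Subsingleton.countable fun y hy z hz => Subtype.ext ?_
    have h : (y : ℝ) - x = z - x := Eq.trans hy (Eq.symm hz)
    linarith
  measurableSet_rel := by
    simp only [dyadicRel_iff, Set.ofPred_exists]
    refine MeasurableSet.iUnion fun n => MeasurableSet.iUnion fun k => ?_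
    exact measurableSet_eq_fun (by fun_prop) (by fun_prop)
  quasiInvariant α _ := by
    constructor
    · intro h
      rw [comap_subtype_coe_apply measurableSet_Ico volume] at h ⊢
      have hsub : Subtype.val '' {y | ∃ x ∈ α, dyadicRel x y} ⊆
          ⋃ (n : ℕ) (k : ℤ), (fun t => t + (k : ℝ) / 2 ^ n) '' (Subtype.val '' α) := by
        rintro _ ⟨y, ⟨x, hx, hxy⟩, rfl⟩
        obtain ⟨n, k, hk⟩ := (dyadicRel_iff x y).1 hxy
        simp only [Set.mem_iUnion]
        exact ⟨n, k, x, ⟨x, hx, rfl⟩, by simp only; rw [← hk]; ring⟩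
      refine measure_mono_null hsub ?_
      refine measure_iUnion_null fun n => measure_iUnion_null fun k => ?_
      rw [Set.image_add_right, measure_preimage_add_right]
      exact h
    · exact measure_mono_null fun x hx => ⟨x, hx, dyadicRel_equivalence.refl x⟩
  σ := fun _ _ _ => 1
  measurable_cocycle := measurable_const
  cocycle := by simp
  normalised := by simp

theorem measurable_dyadic_slice_count :
    Measurable fun y => Measure.count.restrict (dyadicFeldmanMoore.hSlice Set.univ y) := by
  have := dyadicFeldmanMoore.standardBorel
  have hG : StandardBorelSpace dyadicFeldmanMoore.Graph :=
    dyadicFeldmanMoore.measurableSet_rel.standardBorel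
  have hsl : ∀ y, MeasurableSet (dyadicFeldmanMoore.hSlice Set.univ y) := fun y => by
    have : dyadicFeldmanMoore.hSlice Set.univ y =
        (fun p : dyadicFeldmanMoore.Graph => p.1.2) ⁻¹' {y} := by
      ext p; simp [FeldmanMoore.hSlice]
    rw [this]
    exact (measurable_snd.comp measurable_subtype_coe) (measurableSet_singleton y)
  let Q : Set ℝ := Set.range fun q : ℕ × ℤ => (q.2 : ℝ) / 2 ^ q.1
  have : Countable Q := (Set.countable_range _).to_subtype
  let D : Q → Set dyadicFeldmanMoore.Graph := fun q => {p | (p.1.2 : ℝ) - p.1.1 = q}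
  have hD : ∀ q, MeasurableSet (D q) := fun q =>
    measurableSet_eq_fun (by fun_prop) (by fun_prop)
  have hDdisj : Pairwise (Function.onFun Disjoint D) := fun q q' hne =>
    Set.disjoint_left.2 fun p h h' => hne (Subtype.ext (Eq.trans (Eq.symm h) h'))
  have hDun : ⋃ q, D q = Set.univ := Set.eq_univ_of_forall fun p => by
    obtain ⟨n, k, h⟩ := (dyadicRel_iff _ _).1 p.2
    exact Set.mem_iUnion.2 ⟨⟨_, ⟨(n, k), rfl⟩⟩, h⟩
  refine Measure.measurable_of_measurable_coe _ fun E hE => ?_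
  have hinj : ∀ q, Set.InjOn (fun p : dyadicFeldmanMoore.Graph => p.1.2) (E ∩ D q) := by
    rintro q p ⟨-, hp⟩ p' ⟨-, hp'⟩ h
    have h1 : (p.1.2 : ℝ) - p.1.1 = p'.1.2 - p'.1.1 := Eq.trans hp (Eq.symm hp')
    have h2 : p.1.2 = p'.1.2 := h
    rw [h2] at h1
    exact Subtype.ext (Prod.ext (Subtype.ext (by linarith)) h2)
  have key : ∀ y, (Measure.count.restrict (dyadicFeldmanMoore.hSlice Set.univ y)) E =
      ∑' q, Set.indicator ((fun p : dyadicFeldmanMoore.Graph => p.1.2) '' (E ∩ D q))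
        (fun _ => (1 : ℝ≥0∞)) y := fun y => by
    rw [Measure.restrict_apply hE]
    have : E ∩ dyadicFeldmanMoore.hSlice Set.univ y =
        ⋃ q, E ∩ dyadicFeldmanMoore.hSlice Set.univ y ∩ D q := by
      rw [← Set.inter_iUnion, hDun, Set.inter_univ]
    rw [this, measure_iUnion
      (fun q q' h => (hDdisj h).mono Set.inter_subset_right Set.inter_subset_right)
      (fun q => (hE.inter (hsl y)).inter (hD q))]
    refine tsum_congr fun q => ?_
    by_cases hy : y ∈ (fun p : dyadicFeldmanMoore.Graph => p.1.2) '' (E ∩ D q)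
    · rw [Set.indicator_of_mem hy]
      obtain ⟨p, hp, hpy⟩ := hy
      have : E ∩ dyadicFeldmanMoore.hSlice Set.univ y ∩ D q = {p} := by
        ext p'
        constructor
        · rintro ⟨⟨h1, -, h2⟩, h3⟩
          exact hinj q ⟨h1, h3⟩ hp (Eq.trans h2 (Eq.symm hpy))
        · rintro rfl
          exact ⟨⟨hp.1, trivial, hpy⟩, hp.2⟩
      rw [this, Measure.count_singleton]
    · rw [Set.indicator_of_notMem hy]
      have : E ∩ dyadicFeldmanMoore.hSlice Set.univ y ∩ D q = ∅ :=
        Set.eq_empty_of_forall_notMem fun p ⟨⟨h1, _, h2⟩, h3⟩ => hy ⟨p, ⟨h1, h3⟩, h2⟩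
      rw [this, measure_empty]
  rw [show (fun y => (Measure.count.restrict (dyadicFeldmanMoore.hSlice Set.univ y)) E) = _ from
    funext key]
  refine Measurable.tsum fun q => measurable_const.indicator ?_
  exact (hE.inter (hD q)).image_of_measurable_injOn
    (measurable_snd.comp measurable_subtype_coe) (hinj q)

/-- In the dyadic model the right counting measure is `ν(E) = ∫ |E_y| dμ(y)`. -/
theorem dyadic_ν_apply (E : Set dyadicFeldmanMoore.Graph) (hE : MeasurableSet E) :
    dyadicFeldmanMoore.ν E =
      ∫⁻ y, ((dyadicFeldmanMoore.hSlice E y).encard : ℝ≥0∞) ∂dyadicFeldmanMoore.μ := by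
  have := dyadicFeldmanMoore.standardBorel
  rw [FeldmanMoore.ν, Measure.bind_apply hE measurable_dyadic_slice_count.aemeasurable]
  refine lintegral_congr fun y => ?_
  have hs : E ∩ dyadicFeldmanMoore.hSlice Set.univ y = dyadicFeldmanMoore.hSlice E y := by
    ext p; simp [FeldmanMoore.hSlice]
  have hm : MeasurableSet (dyadicFeldmanMoore.hSlice E y) := by
    have : dyadicFeldmanMoore.hSlice E y =
        E ∩ (fun p : dyadicFeldmanMoore.Graph => p.1.2) ⁻¹' {y} := by
      ext p; simp [FeldmanMoore.hSlice]
    rw [this]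
    exact hE.inter ((measurable_snd.comp measurable_subtype_coe) (measurableSet_singleton y))
  rw [Measure.restrict_apply hE, hs, Measure.count_apply hm]

/-! The circle translations that stay inside the relation form a countable group `D`. Their graphs
partition the relation, so ν is a countable sum of copies of Lebesgue measure.

Formally, the operator with symbol a ⋆ b sends ξ to Σ_y a(x,y) b(x,y) ξ(y,z), but an element A of M
with symbol a need not act by convergent sums. Put r = x − z. Then b(x,y) = b(z+r,y) depends only on
r and (y,z). With M_r the multiplication by (y,z) ↦ b(z+r,y), the wanted value at (x,z) is (A M_r
ξ)(x,z), which makes sense for every operator A (`exists_schur`). Let S be the resulting operator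
and B the operator with symbol b. Using A M_r ξ only on the graph of r gives ‖Sξ‖² ≤ Σ_r ‖A‖² ‖M_r
ξ‖² = ‖A‖² ∫ Σ_r |b(z+r,y)|² |ξ(y,z)|² dν. The inner sum runs over column y of b and is at most ‖B‖²
(`tsum_column_le`).

That S lies in M follows from `mem_vN_iff`: M is the commutant of the right operators φ(z) ξ(x,z+c).
This is a commutation theorem (`commute_of_tracial`), because χ_Δ is a tracial vector for the left
and the right operators and each family carries it to a total set. Right operators permute the M_r,
so S commutes with them (`commute_schur`). -/

namespace DyadicRelation

noncomputable section

/-! ### The dyadic relation as a union of graphs of circle translations. -/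

/-- The unit interval `[0, 1)`. -/
abbrev I : Type := Set.Ico (0 : ℝ) 1

/-- The dyadic relation as a set of pairs. -/
abbrev G : Type := dyadicFeldmanMoore.Graph

/-- Lebesgue measure on `[0, 1)`. -/
abbrev leb : Measure I := dyadicFeldmanMoore.μ

/-- The right counting measure of the dyadic relation. -/
abbrev rcm : Measure G := dyadicFeldmanMoore.ν

/-- The `L²` space of the dyadic relation. -/
abbrev K : Type := dyadicFeldmanMoore.H

instance : StandardBorelSpace G :=
  have := dyadicFeldmanMoore.standardBorel
  dyadicFeldmanMoore.measurableSet_rel.standardBorel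

instance : IsProbabilityMeasure leb := dyadicFeldmanMoore.isProb

instance : StandardBorelSpace I := measurableSet_Ico.standardBorel

theorem leb_apply {A : Set I} : leb A = volume (Subtype.val '' A) :=
  comap_subtype_coe_apply measurableSet_Ico volume A

theorem equivIco_mem_Ico (c : UnitAddCircle) :
    (AddCircle.equivIco 1 0 c : ℝ) ∈ Set.Ico (0 : ℝ) 1 := by
  simpa using (AddCircle.equivIco 1 0 c).2

/-- The quotient map identifies `[0, 1)` with the circle. -/
def toCircle : I ≃ᵐ UnitAddCircle where
  toFun x := ((x : ℝ) : UnitAddCircle)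
  invFun c := ⟨AddCircle.equivIco 1 0 c, equivIco_mem_Ico c⟩
  left_inv x := by
    have : (x : ℝ) ∈ Set.Ico (0 : ℝ) (0 + 1) := by simp
    have h := congrArg Subtype.val (AddCircle.equivIco_coe_eq this)
    exact Subtype.ext h
  right_inv c := AddCircle.coe_equivIco
  measurable_toFun := AddCircle.measurable_mk'.comp measurable_subtype_coe
  measurable_invFun := Measurable.subtype_mk (measurable_subtype_coe.comp
    (AddCircle.measurableEquivIco 1 0).measurable) (h := equivIco_mem_Ico)

theorem toCircle_apply (x : I) : toCircle x = ((x : ℝ) : UnitAddCircle) := rfl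

theorem measurePreserving_toCircle : MeasurePreserving toCircle leb volume := by
  refine ⟨toCircle.measurable, Measure.ext fun U hU => ?_⟩
  rw [Measure.map_apply toCircle.measurable hU, leb_apply,
    AddCircle.add_projection_respects_measure 1 0 hU, zero_add]
  have : Subtype.val '' (toCircle ⁻¹' U) =
      QuotientAddGroup.mk ⁻¹' U ∩ Set.Ico (0 : ℝ) 1 := by
    ext x
    constructor
    · rintro ⟨y, hy, rfl⟩
      exact ⟨hy, y.2⟩
    · rintro ⟨h1, h2⟩
      exact ⟨⟨x, h2⟩, h1, rfl⟩
  rw [this]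
  exact measure_congr (Filter.EventuallyEq.rfl.inter Ico_ae_eq_Ioc)

/-- Translation by `c` modulo 1 on `[0, 1)`. -/
def T (c : UnitAddCircle) (x : I) : I := toCircle.symm (toCircle x + c)

theorem toCircle_T (c : UnitAddCircle) (x : I) : toCircle (T c x) = toCircle x + c := by
  simp [T]

theorem T_add (c d : UnitAddCircle) (x : I) : T (c + d) x = T c (T d x) :=
  toCircle.injective (by simp only [toCircle_T]; abel)

@[simp] theorem T_zero (x : I) : T 0 x = x := toCircle.injective (by simp [toCircle_T])

@[simp] theorem T_neg_T (c : UnitAddCircle) (x : I) : T (-c) (T c x) = x := by simp [← T_add]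

@[simp] theorem T_T_neg (c : UnitAddCircle) (x : I) : T c (T (-c) x) = x := by simp [← T_add]

theorem T_sub_self (x y : I) : T (toCircle y - toCircle x) x = y :=
  toCircle.injective (by simp [toCircle_T])

theorem T_left_injective (x : I) : Function.Injective fun c => T c x := fun c d h => by
  simpa [toCircle_T] using congrArg toCircle h

theorem measurePreserving_T (c : UnitAddCircle) : MeasurePreserving (T c) leb leb :=
  (measurePreserving_toCircle.symm toCircle).comp
    ((measurePreserving_add_right volume c).comp measurePreserving_toCircle)

@[fun_prop] theorem measurable_T (c : UnitAddCircle) : Measurable (T c) :=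
  (measurePreserving_T c).measurable

/-- Differences that agree on the circle differ by an integer, and adding an integer keeps a number
dyadic. -/
theorem dyadicRel_T_sub {x y : I} (h : dyadicRel x y) (z : I) :
    dyadicRel z (T (toCircle y - toCircle x) z) := by
  obtain ⟨n, k, hk⟩ := (dyadicRel_iff x y).1 h
  have h1 := toCircle_T (toCircle y - toCircle x) z
  set w := T (toCircle y - toCircle x) z
  simp only [toCircle_apply] at h1
  have h2 : (((w : ℝ) - z - (y - x) : ℝ) : UnitAddCircle) = 0 := by
    rw [AddCircle.coe_sub, AddCircle.coe_sub, AddCircle.coe_sub, h1]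
    abel
  obtain ⟨m, hm⟩ := (AddCircle.coe_eq_zero_iff 1).1 h2
  refine (dyadicRel_iff z w).2 ⟨n, k + m * 2 ^ n, ?_⟩
  rw [zsmul_one] at hm
  have : (w : ℝ) - z = k / 2 ^ n + m := by linarith
  rw [this]
  push_cast
  field_simp

/-- The group of translations whose graphs make up the dyadic relation. -/
def D : AddSubgroup UnitAddCircle where
  -- With this carrier the subgroup axioms are the axioms of an equivalence relation.
  carrier := {c | ∀ x, dyadicRel x (T c x)}
  zero_mem' x := by simpa using dyadicRel_equivalence.refl x
  add_mem' := fun {c d} hc hd x => by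
    rw [T_add]
    exact dyadicRel_equivalence.trans (hd x) (hc _)
  neg_mem' := fun {c} hc x => by
    simpa using dyadicRel_equivalence.symm (hc (T (-c) x))

theorem dyadicRel_T (c : D) (x : I) : dyadicRel x (T c x) := c.2 x

theorem sub_mem_D {x y : I} (h : dyadicRel x y) : toCircle y - toCircle x ∈ D :=
  fun z => dyadicRel_T_sub h z

/-- A translation is determined by the image of one point, so `D` injects into the countable class
of 0. -/
instance : Countable D := by
  let x : I := ⟨0, by simp⟩
  have : Countable {y // dyadicRel x y} := (dyadicFeldmanMoore.countable_class x).to_subtype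
  exact Function.Injective.countable
    (f := fun c : D => (⟨T c x, dyadicRel_T c x⟩ : {y // dyadicRel x y}))
    fun c d h => Subtype.ext (T_left_injective x (congrArg Subtype.val h))

/-- The point `(z + s, z)` of the dyadic relation. -/
def graphPt (s : D) (z : I) : G := ⟨(T s z, z), dyadicRel_equivalence.symm (dyadicRel_T s z)⟩

/-- The difference `x - z` of a point `(x, z)` of the dyadic relation. -/
def diff (p : G) : D :=
  ⟨toCircle p.1.1 - toCircle p.1.2, sub_mem_D (dyadicRel_equivalence.symm p.2)⟩

@[simp] theorem diff_graphPt (s : D) (z : I) : diff (graphPt s z) = s :=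
  Subtype.ext (by simp [diff, graphPt, toCircle_T])

@[simp] theorem graphPt_diff (p : G) : graphPt (diff p) p.1.2 = p :=
  Subtype.ext (Prod.ext (T_sub_self _ _) rfl)

theorem graphPt_injective (s : D) : Function.Injective (graphPt s) := fun _ _ h =>
  congrArg (fun p : G => p.1.2) h

theorem graphPt_left_injective (z : I) : Function.Injective fun s => graphPt s z := fun s t h => by
  simpa using congrArg diff h

@[fun_prop] theorem measurable_fst : Measurable fun p : G => p.1.1 :=
  _root_.measurable_fst.comp measurable_subtype_coe

@[fun_prop] theorem measurable_snd : Measurable fun p : G => p.1.2 :=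
  _root_.measurable_snd.comp measurable_subtype_coe

theorem measurable_graphPt (s : D) : Measurable (graphPt s) :=
  ((measurable_T s).prodMk measurable_id).subtype_mk

theorem measurableEmbedding_graphPt (s : D) : MeasurableEmbedding (graphPt s) :=
  (measurable_graphPt s).measurableEmbedding (graphPt_injective s)

theorem measurable_diff_coe : Measurable fun p : G => (diff p : UnitAddCircle) :=
  (toCircle.measurable.comp measurable_fst).sub (toCircle.measurable.comp measurable_snd)

/-! ### The right counting measure along the graphs. -/

theorem rcm_eq_sum : rcm = Measure.sum fun s => leb.map (graphPt s) := by
  refine Measure.ext fun E hE => ?_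
  rw [dyadic_ν_apply E hE, Measure.sum_apply _ hE]
  simp_rw [Measure.map_apply (measurable_graphPt _) hE]
  have (s : D) : leb (graphPt s ⁻¹' E) = ∫⁻ z, (graphPt s ⁻¹' E).indicator 1 z ∂leb :=
    (lintegral_indicator_one (measurable_graphPt s hE)).symm
  simp_rw [this]
  rw [← lintegral_tsum fun s =>
    (measurable_one.indicator (measurable_graphPt s hE)).aemeasurable]
  refine lintegral_congr fun z => ?_
  -- The slice over `z` meets each graph exactly once, so counting its points is counting elements
  -- of `D`.
  have h : dyadicFeldmanMoore.hSlice E z = (fun s => graphPt s z) '' {s | graphPt s z ∈ E} := by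
    ext p
    constructor
    · rintro ⟨hp, rfl⟩
      exact ⟨diff p, by simpa using hp, by simp⟩
    · rintro ⟨s, hs, rfl⟩
      exact ⟨hs, rfl⟩
  rw [h, (graphPt_left_injective z).encard_image, ← ENNReal.tsum_set_one,
    tsum_subtype _ fun _ => (1 : ℝ≥0∞)]
  rfl

theorem ae_rcm_iff {P : G → Prop} :
    (∀ᵐ p ∂rcm, P p) ↔ ∀ s, ∀ᵐ z ∂leb, P (graphPt s z) := by
  rw [rcm_eq_sum, Measure.ae_sum_iff]
  exact forall_congr' fun s => (measurableEmbedding_graphPt s).ae_map_iff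

theorem lintegral_rcm (F : G → ℝ≥0∞) :
    ∫⁻ p, F p ∂rcm = ∑' s, ∫⁻ z, F (graphPt s z) ∂leb := by
  rw [rcm_eq_sum, lintegral_sum_measure]
  exact tsum_congr fun s => (measurableEmbedding_graphPt s).lintegral_map F

theorem ae_rcm_of_ae_snd {P : I → Prop} (h : ∀ᵐ z ∂leb, P z) : ∀ᵐ p ∂rcm, P p.1.2 :=
  ae_rcm_iff.2 fun _ => h

theorem ae_rcm_of_ae_fst {P : I → Prop} (h : ∀ᵐ z ∂leb, P z) : ∀ᵐ p ∂rcm, P p.1.1 :=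
  ae_rcm_iff.2 fun s => (measurePreserving_T s).quasiMeasurePreserving.ae h

/-- By countability of `D`, a null set meets only a null family of horizontal slices. This allows
a.e. identities to be used in every term of a convolution sum at once. -/
theorem ae_slice {P : G → Prop} (h : ∀ᵐ p ∂rcm, P p) :
    ∀ᵐ p ∂rcm, ∀ q : G, q.1.2 = p.1.2 → P q := by
  refine ae_rcm_of_ae_snd (P := fun z => ∀ q : G, q.1.2 = z → P q) ?_
  filter_upwards [ae_all_iff.2 (ae_rcm_iff.1 h)] with z hz q hq
  subst hq
  simpa using hz (diff q)

/-! ### Measure-preserving maps of the relation. -/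

/-- A map permuting the graphs of the translations, up to translations of the base, preserves the
right counting measure. -/
theorem measurePreserving_of_graphPt {θ : G → G} (hθ : Measurable θ) (π : D ≃ D)
    (t : D → UnitAddCircle) (h : ∀ s z, θ (graphPt s z) = graphPt (π s) (T (t s) z)) :
    MeasurePreserving θ rcm rcm := by
  refine ⟨hθ, Measure.ext_of_lintegral _ fun F hF => ?_⟩
  rw [lintegral_map hF hθ, lintegral_rcm, lintegral_rcm,
    ← π.tsum_eq fun s => ∫⁻ z, F (graphPt s z) ∂leb]
  refine tsum_congr fun s => ?_
  simp_rw [h]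
  exact (measurePreserving_T (t s)).lintegral_comp (hF.comp (measurable_graphPt _))

/-- The coordinate flip `(x, z) ↦ (z, x)`. -/
def flip (p : G) : G := ⟨(p.1.2, p.1.1), dyadicRel_equivalence.symm p.2⟩

/-- Translation of the second coordinate. -/
def translateRight (c : D) (p : G) : G :=
  ⟨(p.1.1, T c p.1.2), dyadicRel_equivalence.trans p.2 (dyadicRel_T c _)⟩

/-- Translation of the first coordinate. -/
def translateLeft (c : D) (p : G) : G :=
  ⟨(T c p.1.1, p.1.2),
    dyadicRel_equivalence.trans (dyadicRel_equivalence.symm (dyadicRel_T c _)) p.2⟩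

/-- The map `(y, z) ↦ (z + c, y)`. -/
def rotate (c : D) (p : G) : G := flip (translateRight c p)

/-- Unimodularity: (z+s, z) goes to the graph of −s over z+s, and translations preserve Lebesgue
measure. The tracial property of χ_Δ rests on this. -/
theorem measurePreserving_flip : MeasurePreserving flip rcm rcm := by
  refine measurePreserving_of_graphPt (by unfold flip; fun_prop) (Equiv.neg D) (fun s => s)
    fun s z => Subtype.ext (Prod.ext ?_ rfl)
  simp [flip, graphPt]

theorem measurePreserving_translateRight (c : D) :
    MeasurePreserving (translateRight c) rcm rcm := by
  refine measurePreserving_of_graphPt (by unfold translateRight; fun_prop) (Equiv.subRight c)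
    (fun _ => c) fun s z => Subtype.ext (Prod.ext ?_ rfl)
  simp [translateRight, graphPt, ← T_add]

theorem measurePreserving_translateLeft (c : D) :
    MeasurePreserving (translateLeft c) rcm rcm := by
  refine measurePreserving_of_graphPt (by unfold translateLeft; fun_prop) (Equiv.addLeft c)
    (fun _ => 0) fun s z => Subtype.ext (Prod.ext ?_ ?_)
  · simp [translateLeft, graphPt, ← T_add]
  · simp [translateLeft, graphPt]

theorem measurePreserving_rotate (c : D) : MeasurePreserving (rotate c) rcm rcm :=
  measurePreserving_flip.comp (measurePreserving_translateRight c)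

end

end DyadicRelation

/-! ### An abstract commutation theorem for a tracial vector. -/

section Commutation

open ContinuousLinearMap

variable {E : Type*} [NormedAddCommGroup E] [InnerProductSpace ℂ E] [CompleteSpace E]

/-- The tracial identity passes from `W` to its commutant: ⟨wΩ, S*Ω⟩ = ⟨wSΩ, Ω⟩ = ⟨SΩ, J(wΩ)⟩ = ⟨wΩ,
J(SΩ)⟩, and the vectors wΩ are total. -/
theorem adjoint_apply_eq_of_commute {Ω : E} {J : E → E}
    (hJ : ∀ x y, inner ℂ (J x) y = inner ℂ (J y) x) {W : Set (E →L[ℂ] E)}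
    (hW : ∀ w ∈ W, adjoint w Ω = J (w Ω))
    (totalW : ∀ ξ : E, (∀ w ∈ W, inner ℂ (w Ω) ξ = 0) → ξ = 0)
    {S : E →L[ℂ] E} (hS : ∀ w ∈ W, Commute S w) : adjoint S Ω = J (S Ω) := by
  rw [← sub_eq_zero]
  refine totalW _ fun w hw => ?_
  have h : S (w Ω) = w (S Ω) := DFunLike.congr_fun (hS w hw).eq Ω
  rw [inner_sub_right, adjoint_inner_right, h, ← adjoint_inner_right, hW w hw,
    ← inner_conj_symm (w Ω), hJ, inner_conj_symm, sub_self]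

/-- Two families `V` and `W` of operators with a common tracial vector `Ω` have commuting
commutants. -/
theorem commute_of_tracial {Ω : E} {J : E → E}
    (hJ : ∀ x y, inner ℂ (J x) y = inner ℂ (J y) x) {V W : Set (E →L[ℂ] E)}
    (hV : ∀ v ∈ V, adjoint v Ω = J (v Ω)) (hW : ∀ w ∈ W, adjoint w Ω = J (w Ω))
    (adjV : ∀ v ∈ V, adjoint v ∈ V) (hVW : ∀ v ∈ V, ∀ w ∈ W, Commute v w)
    (totalV : ∀ ξ : E, (∀ v ∈ V, inner ℂ (v Ω) ξ = 0) → ξ = 0)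
    (totalW : ∀ ξ : E, (∀ w ∈ W, inner ℂ (w Ω) ξ = 0) → ξ = 0)
    {S U : E →L[ℂ] E} (hS : ∀ w ∈ W, Commute S w) (hU : ∀ v ∈ V, Commute U v) :
    Commute S U := by
  -- With Y = v'* S v, which commutes with `W`: ⟨v'Ω, USvΩ⟩ = ⟨U*Ω, YΩ⟩ = ⟨J(UΩ), YΩ⟩ = ⟨J(YΩ), UΩ⟩
  -- = ⟨Y*Ω, UΩ⟩ = ⟨v'Ω, SUvΩ⟩.
  have key : ∀ v ∈ V, ∀ v' ∈ V, inner ℂ (v' Ω) (S (U (v Ω))) = inner ℂ (v' Ω) (U (S (v Ω))) := by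
    intro v hv v' hv'
    have hY : ∀ w ∈ W, Commute (adjoint v' * S * v) w := fun w hw =>
      ((hVW _ (adjV _ hv') w hw).mul_left (hS w hw)).mul_left (hVW v hv w hw)
    have h1 : U (v Ω) = v (U Ω) := DFunLike.congr_fun (hU v hv).eq Ω
    have h2 : adjoint U (v' Ω) = v' (adjoint U Ω) := by
      have := congrArg adjoint (hU _ (adjV _ hv')).eq
      simp only [mul_def, adjoint_comp, adjoint_adjoint] at this
      exact (DFunLike.congr_fun this Ω).symm
    rw [← adjoint_inner_left U, h2, ← adjoint_inner_right v' (adjoint U Ω),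
      adjoint_apply_eq_of_commute hJ hV totalV hU]
    change _ = inner ℂ _ ((adjoint v' * S * v) Ω)
    rw [hJ, ← adjoint_apply_eq_of_commute hJ hW totalW hY, adjoint_inner_left, h1]
    exact (adjoint_inner_right v' _ _).symm
  have hzero : ∀ v ∈ V, (S * U - U * S) (v Ω) = 0 := fun v hv =>
    totalV _ fun v' hv' => by
      change inner ℂ (v' Ω) (S (U (v Ω)) - U (S (v Ω))) = 0
      rw [inner_sub_right, key v hv v' hv', sub_self]
  refine sub_eq_zero.1 (ContinuousLinearMap.ext fun x => ?_)
  -- The commutator C kills every vΩ, so C*Cx is orthogonal to a total set; hence ‖Cx‖² = ⟨C*Cx, x⟩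
  -- = 0.
  have : adjoint (S * U - U * S) ((S * U - U * S) x) = 0 := totalV _ fun v hv => by
    rw [adjoint_inner_right, hzero v hv, inner_zero_left]
  have h := adjoint_inner_left (S * U - U * S) x ((S * U - U * S) x)
  rw [this, inner_zero_left] at h
  exact inner_self_eq_zero.1 h.symm

end Commutation

/-! ### Left and right operators on the L² space, and their action on χ_Δ. -/

namespace DyadicRelation

noncomputable section

open ContinuousLinearMap

@[simp] theorem diff_flip (p : G) : diff (flip p) = -diff p := Subtype.ext (by simp [diff, flip])

@[simp] theorem diff_translateRight (c : D) (p : G) : diff (translateRight c p) = diff p - c :=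
  Subtype.ext (by simp [diff, translateRight, toCircle_T, sub_sub])

@[simp] theorem diff_translateLeft (c : D) (p : G) : diff (translateLeft c p) = diff p + c :=
  Subtype.ext (by simp [diff, translateLeft, toCircle_T, sub_add_eq_add_sub])

theorem fst_eq_T (p : G) : p.1.1 = T (diff p) p.1.2 := (T_sub_self _ _).symm

theorem snd_eq_T (p : G) : p.1.2 = T (-diff p : D) p.1.1 := by
  rw [fst_eq_T p, NegMemClass.coe_neg, T_neg_T]

theorem measurableSet_diff_eq (s : D) : MeasurableSet {p : G | diff p = s} := by
  have : {p : G | diff p = s} = (fun p => (diff p : UnitAddCircle)) ⁻¹' {(s : UnitAddCircle)} := by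
    ext p
    exact Subtype.ext_iff
  rw [this]
  exact measurable_diff_coe (measurableSet_singleton _)

theorem restrict_diff_eq (s : D) :
    rcm.restrict {p | diff p = s} = leb.map (graphPt s) := by
  refine Measure.ext fun E hE => ?_
  rw [Measure.restrict_apply hE, rcm_eq_sum,
    Measure.sum_apply _ (hE.inter (measurableSet_diff_eq s)), tsum_eq_single s]
  · rw [Measure.map_apply (measurable_graphPt s) (hE.inter (measurableSet_diff_eq s)),
      Measure.map_apply (measurable_graphPt s) hE]
    congr 1
    ext z
    simp
  · intro t ht
    rw [Measure.map_apply (measurable_graphPt t) (hE.inter (measurableSet_diff_eq s))]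
    convert measure_empty (μ := leb)
    ext z
    simp [ht]

theorem diff_eq_zero_iff (p : G) : diff p = 0 ↔ p ∈ dyadicFeldmanMoore.diag := by
  rw [Subtype.ext_iff]
  change toCircle p.1.1 - toCircle p.1.2 = 0 ↔ p.1.1 = p.1.2
  rw [sub_eq_zero, toCircle.injective.eq_iff]

open Classical in
theorem coeFn_χΔ :
    (dyadicFeldmanMoore.χΔ : G → ℂ) =ᵐ[rcm] fun p => if diff p = 0 then 1 else 0 := by
  refine indicatorConstLp_coeFn.trans (.of_forall fun p => ?_)
  simp [Set.indicator, diff_eq_zero_iff]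

/-- The modular conjugation `(J ξ)(x, z) = conj (ξ (z, x))`. -/
def J (ξ : K) : K := star (Lp.compMeasurePreserving flip measurePreserving_flip ξ)

theorem coeFn_J (ξ : K) : (J ξ : G → ℂ) =ᵐ[rcm] fun p => star (ξ (flip p)) := by
  filter_upwards [Lp.coeFn_star (Lp.compMeasurePreserving flip measurePreserving_flip ξ),
    Lp.coeFn_compMeasurePreserving ξ measurePreserving_flip] with p h1 h2
  rw [J, h1, Pi.star_apply, h2, Function.comp_apply]

theorem integral_comp_eq {θ : G → G} (hθ : MeasurePreserving θ rcm rcm) {f : G → ℂ}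
    (hf : AEStronglyMeasurable f rcm) : ∫ p, f (θ p) ∂rcm = ∫ p, f p ∂rcm := by
  conv_rhs => rw [← hθ.map_eq]
  exact (integral_map hθ.aemeasurable (by rwa [hθ.map_eq])).symm

/-- Both sides are integrals of a product of one function with the flip of the other; the
measure-preserving involution `flip` exchanges them. -/
theorem inner_J (x y : K) : inner ℂ (J x) y = inner ℂ (J y) x := by
  rw [L2.inner_def, L2.inner_def]
  have h1 : ∫ p, inner ℂ ((J x : K) p) (y p) ∂rcm = ∫ p, x (flip p) * y p ∂rcm := by
    refine integral_congr_ae ?_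
    filter_upwards [coeFn_J x] with p hp
    simp [hp, mul_comm]
  have h2 : ∫ p, inner ℂ ((J y : K) p) (x p) ∂rcm = ∫ p, y (flip p) * x p ∂rcm := by
    refine integral_congr_ae ?_
    filter_upwards [coeFn_J y] with p hp
    simp [hp, mul_comm]
  rw [h1, h2, ← integral_comp_eq measurePreserving_flip (f := fun p => y (flip p) * x p)]
  · exact integral_congr_ae (.of_forall fun p => mul_comm _ _)
  · exact ((Lp.aestronglyMeasurable y).comp_measurePreserving measurePreserving_flip).mul
      (Lp.aestronglyMeasurable x)

/-- Bounded measurable functions. -/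
def BddMeasurable {α : Type*} [MeasurableSpace α] (m : α → ℂ) : Prop :=
  Measurable m ∧ ∃ C : ℝ, ∀ x, ‖m x‖ ≤ C

theorem BddMeasurable.comp {α β : Type*} [MeasurableSpace α] [MeasurableSpace β] {m : β → ℂ}
    (hm : BddMeasurable m) {f : α → β} (hf : Measurable f) : BddMeasurable fun x => m (f x) :=
  ⟨hm.1.comp hf, hm.2.imp fun _ h x => h (f x)⟩

theorem BddMeasurable.star {α : Type*} [MeasurableSpace α] {m : α → ℂ}
    (hm : BddMeasurable m) : BddMeasurable fun x => star (m x) :=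
  ⟨Complex.continuous_conj.measurable.comp hm.1, hm.2.imp fun _ h x => by simpa using h x⟩

theorem BddMeasurable.indicator_one {α : Type*} [MeasurableSpace α] {A : Set α}
    (hA : MeasurableSet A) : BddMeasurable (A.indicator (1 : α → ℂ)) :=
  ⟨measurable_one.indicator hA, 1, fun x => (norm_indicator_le_norm_self _ _).trans (by simp)⟩

/-- `S` is the weighted composition operator `ξ ↦ m · (ξ ∘ θ)`. -/
def IsWeightedComp (S : K →L[ℂ] K) (m : G → ℂ) (θ : G → G) : Prop :=
  ∀ ξ : K, (S ξ : G → ℂ) =ᵐ[rcm] fun p => m p * ξ (θ p)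

/-- Composition with θ is an isometry of L², and multiplication by m is the Hölder pairing of L^∞
with L². -/
theorem exists_isWeightedComp {m : G → ℂ} (hm : BddMeasurable m) {θ : G → G}
    (hθ : MeasurePreserving θ rcm rcm) : ∃ S, IsWeightedComp S m θ := by
  obtain ⟨C, hC⟩ := hm.2
  have hm' : MemLp m ∞ rcm :=
    memLp_top_of_bound hm.1.aestronglyMeasurable C (.of_forall hC)
  refine ⟨((ContinuousLinearMap.mul ℂ ℂ).holderL rcm ∞ 2 2 hm'.toLp).comp
    (Lp.compMeasurePreservingₗᵢ ℂ θ hθ).toContinuousLinearMap, fun ξ => ?_⟩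
  filter_upwards [(ContinuousLinearMap.mul ℂ ℂ).coeFn_holder (r := 2) hm'.toLp
    (Lp.compMeasurePreserving θ hθ ξ), Lp.coeFn_compMeasurePreserving ξ hθ, hm'.coeFn_toLp]
    with p h1 h2 h3
  refine Eq.trans h1 ?_
  rw [h2, h3]
  rfl

theorem IsWeightedComp.ext {S S' : K →L[ℂ] K} {m m' : G → ℂ} {θ : G → G}
    (h : IsWeightedComp S m θ) (h' : IsWeightedComp S' m' θ) (hm : ∀ p, m p = m' p) : S = S' :=
  ContinuousLinearMap.ext fun ξ => Lp.ext (by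
    filter_upwards [h ξ, h' ξ] with p h1 h2
    rw [h1, h2, hm])

theorem IsWeightedComp.adjoint {S : K →L[ℂ] K} {m : G → ℂ} {θ θ' : G → G}
    (h : IsWeightedComp S m θ) (hm : BddMeasurable m) (hθ : MeasurePreserving θ rcm rcm)
    (hθ' : MeasurePreserving θ' rcm rcm) (hinv : ∀ p, θ' (θ p) = p) :
    IsWeightedComp (adjoint S) (fun p => star (m (θ' p))) θ' := by
  obtain ⟨S', hS'⟩ := exists_isWeightedComp (hm.comp hθ'.measurable).star hθ'
  suffices S' = ContinuousLinearMap.adjoint S from this ▸ hS'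
  rw [eq_adjoint_iff]
  intro x y
  rw [L2.inner_def, L2.inner_def]
  have h1 : ∫ p, inner ℂ (S' x p) (y p) ∂rcm = ∫ p, star (x (θ' p)) * m (θ' p) * y p ∂rcm := by
    refine integral_congr_ae ?_
    filter_upwards [hS' x] with p hp
    simp [hp]
    ring
  rw [h1, ← integral_comp_eq hθ]
  · refine integral_congr_ae ?_
    filter_upwards [h y] with p hp
    simp [hp, hinv]
    ring
  · exact ((((Lp.aestronglyMeasurable x).comp_measurePreserving hθ').star).mul
      (hm.comp hθ'.measurable).1.aestronglyMeasurable).mul (Lp.aestronglyMeasurable y)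

/-- The operators `(S ξ)(x, z) = φ(z) ξ(x, z + c)`. -/
def rightOps : Set (K →L[ℂ] K) :=
  {S | ∃ φ : I → ℂ, BddMeasurable φ ∧ ∃ c, IsWeightedComp S (fun p => φ p.1.2) (translateRight c)}

/-- The operators `(S ξ)(x, z) = φ(x) ξ(x + c, z)`. -/
def leftOps : Set (K →L[ℂ] K) :=
  {S | ∃ φ : I → ℂ, BddMeasurable φ ∧ ∃ c, IsWeightedComp S (fun p => φ p.1.1) (translateLeft c)}

theorem translateRight_neg_translateRight (c : D) (p : G) :
    translateRight (-c) (translateRight c p) = p :=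
  Subtype.ext (Prod.ext rfl (by simp [translateRight]))

theorem translateLeft_neg_translateLeft (c : D) (p : G) :
    translateLeft (-c) (translateLeft c p) = p :=
  Subtype.ext (Prod.ext (by simp [translateLeft]) rfl)

theorem translateRight_snd (c : D) (p : G) : (translateRight c p).1.2 = T c p.1.2 := rfl

theorem translateLeft_fst (c : D) (p : G) : (translateLeft c p).1.1 = T c p.1.1 := rfl

theorem isWeightedComp_adjoint_right {S : K →L[ℂ] K} {φ : I → ℂ} (hφ : BddMeasurable φ) {c : D}
    (h : IsWeightedComp S (fun p => φ p.1.2) (translateRight c)) :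
    IsWeightedComp (adjoint S) (fun p => star (φ (T (-c : D) p.1.2))) (translateRight (-c)) := by
  have h' := h.adjoint (hφ.comp measurable_snd) (measurePreserving_translateRight c)
    (measurePreserving_translateRight (-c)) (translateRight_neg_translateRight c)
  simpa only [translateRight_snd] using h'

theorem isWeightedComp_adjoint_left {S : K →L[ℂ] K} {φ : I → ℂ} (hφ : BddMeasurable φ) {c : D}
    (h : IsWeightedComp S (fun p => φ p.1.1) (translateLeft c)) :
    IsWeightedComp (adjoint S) (fun p => star (φ (T (-c : D) p.1.1))) (translateLeft (-c)) := by
  have h' := h.adjoint (hφ.comp measurable_fst) (measurePreserving_translateLeft c)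
    (measurePreserving_translateLeft (-c)) (translateLeft_neg_translateLeft c)
  simpa only [translateLeft_fst] using h'

theorem adjoint_mem_rightOps {S : K →L[ℂ] K} (hS : S ∈ rightOps) : adjoint S ∈ rightOps := by
  obtain ⟨φ, hφ, c, h⟩ := hS
  exact ⟨_, (hφ.comp (measurable_T (-c : D))).star, -c, isWeightedComp_adjoint_right hφ h⟩

theorem adjoint_mem_leftOps {S : K →L[ℂ] K} (hS : S ∈ leftOps) : adjoint S ∈ leftOps := by
  obtain ⟨φ, hφ, c, h⟩ := hS
  exact ⟨_, (hφ.comp (measurable_T (-c : D))).star, -c, isWeightedComp_adjoint_left hφ h⟩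

-- `translateRight c p` is diagonal exactly when `diff p = c`, so χ_Δ is moved to a function carried
-- by one graph.
open Classical in
theorem right_apply_χΔ {S : K →L[ℂ] K} {φ : I → ℂ} {c : D}
    (h : IsWeightedComp S (fun p => φ p.1.2) (translateRight c)) :
    (S dyadicFeldmanMoore.χΔ : G → ℂ) =ᵐ[rcm] fun p => if diff p = c then φ p.1.2 else 0 := by
  filter_upwards [h dyadicFeldmanMoore.χΔ,
    (measurePreserving_translateRight c).quasiMeasurePreserving.ae coeFn_χΔ] with p h1 h2
  rw [h1, h2]
  simp [sub_eq_zero]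

open Classical in
theorem left_apply_χΔ {S : K →L[ℂ] K} {φ : I → ℂ} {c : D}
    (h : IsWeightedComp S (fun p => φ p.1.1) (translateLeft c)) :
    (S dyadicFeldmanMoore.χΔ : G → ℂ) =ᵐ[rcm] fun p => if diff p = -c then φ p.1.1 else 0 := by
  filter_upwards [h dyadicFeldmanMoore.χΔ,
    (measurePreserving_translateLeft c).quasiMeasurePreserving.ae coeFn_χΔ] with p h1 h2
  rw [h1, h2]
  simp [eq_neg_iff_add_eq_zero]

theorem adjoint_right_χΔ {S : K →L[ℂ] K} (hS : S ∈ rightOps) :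
    adjoint S dyadicFeldmanMoore.χΔ = J (S dyadicFeldmanMoore.χΔ) := by
  obtain ⟨φ, hφ, c, h⟩ := hS
  refine Lp.ext ?_
  filter_upwards [right_apply_χΔ (φ := fun z => star (φ (T (-c : D) z))) (c := -c)
      (isWeightedComp_adjoint_right hφ h),
    coeFn_J (S dyadicFeldmanMoore.χΔ),
    measurePreserving_flip.quasiMeasurePreserving.ae (right_apply_χΔ h)] with p h1 h2 h3
  rw [h1, h2, h3]
  simp only [diff_flip, neg_eq_iff_eq_neg]
  split_ifs with hp
  · rw [show (flip p).1.2 = p.1.1 from rfl, fst_eq_T p, hp]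
  · simp

theorem adjoint_left_χΔ {S : K →L[ℂ] K} (hS : S ∈ leftOps) :
    adjoint S dyadicFeldmanMoore.χΔ = J (S dyadicFeldmanMoore.χΔ) := by
  obtain ⟨φ, hφ, c, h⟩ := hS
  refine Lp.ext ?_
  filter_upwards [left_apply_χΔ (φ := fun z => star (φ (T (-c : D) z))) (c := -c)
      (isWeightedComp_adjoint_left hφ h),
    coeFn_J (S dyadicFeldmanMoore.χΔ),
    measurePreserving_flip.quasiMeasurePreserving.ae (left_apply_χΔ h)] with p h1 h2 h3
  rw [h1, h2, h3]
  simp only [diff_flip, neg_inj, neg_neg]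
  split_ifs with hp
  · rw [show (flip p).1.1 = p.1.2 from rfl, snd_eq_T p, hp]
  · simp

theorem commute_left_right {S S' : K →L[ℂ] K} (hS : S ∈ leftOps) (hS' : S' ∈ rightOps) :
    Commute S S' := by
  obtain ⟨φ, hφ, c, h⟩ := hS
  obtain ⟨ψ, hψ, d, h'⟩ := hS'
  refine ContinuousLinearMap.ext fun ξ => Lp.ext ?_
  filter_upwards [h (S' ξ), h' (S ξ),
    (measurePreserving_translateLeft c).quasiMeasurePreserving.ae (h' ξ),
    (measurePreserving_translateRight d).quasiMeasurePreserving.ae (h ξ)] with p h1 h2 h3 h4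
  refine h1.trans (Eq.trans ?_ h2.symm)
  rw [h3, h4]
  change φ p.1.1 * (ψ p.1.2 * _) = ψ p.1.2 * (φ p.1.1 * _)
  rw [mul_left_comm]
  rfl

open Classical in
/-- The indicators of measurable subsets of the graphs of translations are total. -/
theorem eq_zero_of_inner_eq_zero {ξ : K} (h : ∀ (s : D) (A : Set I), MeasurableSet A →
    ∃ u : K, (u : G → ℂ) =ᵐ[rcm] (fun p => if diff p = s ∧ p.1.2 ∈ A then 1 else 0) ∧
      inner ℂ u ξ = 0) : ξ = 0 := by
  refine Lp.ext (Filter.EventuallyEq.trans ?_ (Lp.coeFn_zero ..).symm)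
  refine ae_rcm_iff.2 fun s => ?_
  -- On each graph the measure is a probability, so ξ is integrable there and vanishes once its set
  -- integrals do.
  have hξ : MemLp (fun z => ξ (graphPt s z)) 2 leb := by
    have := (Lp.memLp ξ).restrict {p | diff p = s}
    rw [restrict_diff_eq] at this
    exact (measurableEmbedding_graphPt s).memLp_map_measure_iff.1 this
  refine (hξ.integrable (by norm_num)).ae_eq_zero_of_forall_setIntegral_eq_zero fun A hA _ => ?_
  obtain ⟨u, hu, hu0⟩ := h s A hA
  have hm : MeasurableSet {p : G | p.1.2 ∈ A} := measurable_snd hA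
  rw [← hu0, L2.inner_def]
  have h1 : ∫ p, inner ℂ (u p) (ξ p) ∂rcm =
      ∫ p, ({p : G | p.1.2 ∈ A} ∩ {p | diff p = s}).indicator ξ p ∂rcm := by
    refine integral_congr_ae ?_
    filter_upwards [hu] with p hp
    rw [hp, Set.indicator_apply]
    simp only [Set.mem_inter_iff, Set.mem_ofPred_eq, and_comm (a := diff p = s)]
    split_ifs <;> simp
  rw [h1, integral_indicator (hm.inter (measurableSet_diff_eq s)),
    ← Measure.restrict_restrict hm, restrict_diff_eq,
    (measurableEmbedding_graphPt s).setIntegral_map]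
  rfl

theorem rightOps_total (ξ : K)
    (h : ∀ w ∈ rightOps, inner ℂ (w dyadicFeldmanMoore.χΔ) ξ = 0) : ξ = 0 := by
  classical
  refine eq_zero_of_inner_eq_zero fun s A hA => ?_
  have hφ := BddMeasurable.indicator_one hA
  obtain ⟨w, hw⟩ := exists_isWeightedComp (hφ.comp measurable_snd)
    (measurePreserving_translateRight s)
  refine ⟨_, (right_apply_χΔ hw).trans (.of_forall fun p => ?_), h w ⟨_, hφ, s, hw⟩⟩
  simp only [Set.indicator_apply, ite_and, Pi.one_apply]

theorem leftOps_total (ξ : K)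
    (h : ∀ w ∈ leftOps, inner ℂ (w dyadicFeldmanMoore.χΔ) ξ = 0) : ξ = 0 := by
  classical
  refine eq_zero_of_inner_eq_zero fun s A hA => ?_
  -- Left weights see x, while `A` constrains z; on the graph of s, z = x − s.
  have hφ := BddMeasurable.indicator_one ((measurable_T (-s : D)) hA)
  obtain ⟨w, hw⟩ := exists_isWeightedComp (hφ.comp measurable_fst)
    (measurePreserving_translateLeft (-s))
  refine ⟨_, (left_apply_χΔ hw).trans (.of_forall fun p => ?_), h w ⟨_, hφ, -s, hw⟩⟩
  simp only [neg_neg, ite_and]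
  refine if_ctx_congr Iff.rfl (fun hp => ?_) fun _ => rfl
  rw [snd_eq_T p, hp]
  simp [Set.indicator_apply]

end

end DyadicRelation

/-! ### The von Neumann algebra as the commutant of the right operators. -/

namespace DyadicRelation

noncomputable section

theorem conv_apply (a ξ : G → ℂ) (p : G) :
    dyadicFeldmanMoore.conv a ξ p = ∑' y : {y : I // dyadicRel p.1.1 y},
      a ⟨(p.1.1, y.1), y.2⟩ *
        ξ ⟨(y.1, p.1.2), dyadicRel_equivalence.trans (dyadicRel_equivalence.symm y.2) p.2⟩ := by
  refine tsum_congr fun y => ?_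
  simp [dyadicFeldmanMoore]

/-- The graph of a translation meets every horizontal and every vertical line at most once. -/
theorem bandwidth_diff_eq_lt_top {s : D} {E : Set G} (hE : E ⊆ {p | diff p = s}) :
    dyadicFeldmanMoore.bandwidth E < ⊤ := by
  have h1 (y : I) : (dyadicFeldmanMoore.hSlice E y).encard ≤ 1 := by
    refine Set.encard_le_one_iff_subsingleton.2 ?_
    rintro p ⟨hp, hpy⟩ q ⟨hq, hqy⟩
    rw [← graphPt_diff p, ← graphPt_diff q, hpy, hqy, hE hp, hE hq]
  have h2 (x : I) : (dyadicFeldmanMoore.vSlice E x).encard ≤ 1 := by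
    refine Set.encard_le_one_iff_subsingleton.2 ?_
    rintro p ⟨hp, hpx⟩ q ⟨hq, hqx⟩
    have h : p.1.2 = q.1.2 := by
      rw [snd_eq_T p, snd_eq_T q, hpx, hqx, hE hp, hE hq]
    exact Subtype.ext (Prod.ext (hpx.trans hqx.symm) h)
  refine lt_of_le_of_lt (b := (1 + 1 : ℕ∞)) ?_ (by decide)
  exact iSup_le fun x => iSup_le fun y => add_le_add (h1 x) (h2 y)

/-- φ(x) ξ(x+c, z) is convolution by φ(x) carried on the points (x, x+c), which have difference −c;
the sum has one nonzero term. -/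
theorem leftOps_subset_leftFiniteOperators :
    leftOps ⊆ dyadicFeldmanMoore.leftFiniteOperators := by
  classical
  rintro S ⟨φ, ⟨hφ, C, hC⟩, c, h⟩
  let a : G → ℂ := {p | diff p = -c}.indicator fun p => φ p.1.1
  refine ⟨a, ⟨(hφ.comp measurable_fst).indicator (measurableSet_diff_eq _),
    ⟨C, fun p => (norm_indicator_le_norm_self _ _).trans (hC _)⟩,
    bandwidth_diff_eq_lt_top Set.support_indicator_subset⟩, fun ξ => ?_⟩
  filter_upwards [h ξ] with p hp
  rw [hp, conv_apply, tsum_eq_single ⟨T c p.1.1, dyadicRel_T c _⟩]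
  · have : diff ⟨(p.1.1, T c p.1.1), dyadicRel_T c _⟩ = -c :=
      Subtype.ext (by simp [diff, toCircle_T])
    have ha : a ⟨(p.1.1, T c p.1.1), dyadicRel_T c _⟩ = φ p.1.1 := 
      Set.indicator_of_mem (s := {p : G | diff p = -c}) this _
    rw [ha]
    rfl
  · intro y hy
    have ha : a ⟨(p.1.1, y.1), y.2⟩ = 0 := by
      refine Set.indicator_of_notMem (fun hd => hy (Subtype.ext ?_)) _
      have := snd_eq_T ⟨(p.1.1, y.1), y.2⟩
      rw [show diff ⟨(p.1.1, y.1), y.2⟩ = -c from hd, neg_neg] at this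
      exact this
    rw [ha, zero_mul]

/-- Convolution sums over y with z fixed, while right operators act on z alone. -/
theorem commute_leftFinite_right {S w : K →L[ℂ] K}
    (hS : S ∈ dyadicFeldmanMoore.leftFiniteOperators) (hw : w ∈ rightOps) : Commute S w := by
  obtain ⟨a, -, ha⟩ := hS
  obtain ⟨φ, -, c, h⟩ := hw
  refine ContinuousLinearMap.ext fun ξ => Lp.ext ?_
  filter_upwards [ha (w ξ), h (S ξ), ae_slice (h ξ),
    (measurePreserving_translateRight c).quasiMeasurePreserving.ae (ha ξ)] with p h1 h2 h3 h4
  refine h1.trans (Eq.trans ?_ h2.symm)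
  rw [h4, conv_apply, conv_apply, ← tsum_mul_left]
  refine tsum_congr fun y => ?_
  refine (congrArg _ (h3 ⟨(y.1, p.1.2),
    dyadicRel_equivalence.trans (dyadicRel_equivalence.symm y.2) p.2⟩ rfl)).trans ?_
  exact mul_left_comm _ _ _

/-- Right operators and their adjoints commute with the generators, which gives one direction.
Conversely, the generators include the left operators, so `commute_of_tracial` applies to `S` and
anything in their commutant. -/
theorem mem_vN_iff (S : K →L[ℂ] K) :
    S ∈ dyadicFeldmanMoore.vN ↔ ∀ w ∈ rightOps, Commute S w := by
  have hmem : S ∈ dyadicFeldmanMoore.vN ↔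
      S ∈ StarSubalgebra.centralizer ℂ (StarSubalgebra.centralizer ℂ
        dyadicFeldmanMoore.leftFiniteOperators : Set (K →L[ℂ] K)) := Iff.rfl
  rw [hmem, StarSubalgebra.mem_centralizer_iff]
  constructor
  · intro h w hw
    refine (h w ?_).1.symm
    refine (StarSubalgebra.mem_centralizer_iff ℂ).2 fun g hg =>
      ⟨commute_leftFinite_right hg hw, ?_⟩
    have := congrArg star (commute_leftFinite_right hg (adjoint_mem_rightOps hw)).eq
    rw [star_mul, star_mul, ← ContinuousLinearMap.star_eq_adjoint, star_star] at this
    exact this.symm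
  · intro h U hU
    have key : ∀ U ∈ StarSubalgebra.centralizer ℂ dyadicFeldmanMoore.leftFiniteOperators,
        U * S = S * U := fun U hU =>
      (commute_of_tracial inner_J (fun v => adjoint_left_χΔ) (fun w => adjoint_right_χΔ)
        (fun v => adjoint_mem_leftOps) (fun v hv w hw => commute_left_right hv hw)
        leftOps_total rightOps_total h fun v hv =>
          (((StarSubalgebra.mem_centralizer_iff ℂ).1 hU v
            (leftOps_subset_leftFiniteOperators hv)).1).symm).symm.eq
    exact ⟨key U hU, key _ (star_mem hU)⟩

/-- χ_Δ is separating: operators agreeing there agree on each w χ_Δ, and these vectors are total. -/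
theorem eq_of_apply_χΔ_eq {S S' : K →L[ℂ] K} (hS : ∀ w ∈ rightOps, Commute S w)
    (hS' : ∀ w ∈ rightOps, Commute S' w)
    (h : S dyadicFeldmanMoore.χΔ = S' dyadicFeldmanMoore.χΔ) : S = S' := by
  refine ContinuousLinearMap.ext fun x => sub_eq_zero.1 ?_
  have h0 : ContinuousLinearMap.adjoint (S - S') ((S - S') x) = 0 :=
    rightOps_total _ fun w hw => by
      have h1 : S (w dyadicFeldmanMoore.χΔ) = w (S dyadicFeldmanMoore.χΔ) :=
        DFunLike.congr_fun (hS w hw).eq _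
      have h2 : S' (w dyadicFeldmanMoore.χΔ) = w (S' dyadicFeldmanMoore.χΔ) :=
        DFunLike.congr_fun (hS' w hw).eq _
      rw [ContinuousLinearMap.adjoint_inner_right, _root_.sub_apply, h1, h2, h,
        sub_self, inner_zero_left]
  have h1 := ContinuousLinearMap.adjoint_inner_left (S - S') x ((S - S') x)
  rw [h0, inner_zero_left] at h1
  exact inner_self_eq_zero.1 h1.symm

theorem symbol_injective : Function.Injective dyadicFeldmanMoore.symbol := fun S S' h =>
  Subtype.ext (eq_of_apply_χΔ_eq ((mem_vN_iff _).1 S.2) ((mem_vN_iff _).1 S'.2) (Subtype.ext h))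

theorem symbol_inverseSymbol (a : dyadicFeldmanMoore.symbolSet) :
    dyadicFeldmanMoore.symbol (dyadicFeldmanMoore.inverseSymbol a) = a :=
  congrArg Subtype.val (Function.surjInv_eq Set.rangeFactorization_surjective a)

end

end DyadicRelation

/-! ### Column bounds and the Schur product. -/

namespace DyadicRelation

noncomputable section

open scoped NNReal

theorem enorm_sq_eq_lintegral (ξ : K) : ‖ξ‖ₑ ^ 2 = ∫⁻ p, ‖ξ p‖ₑ ^ 2 ∂rcm := by
  rw [Lp.enorm_def]
  have := eLpNorm_nnreal_pow_eq_lintegral (μ := rcm) (f := ξ) (p := 2) two_ne_zero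
  simpa using this

theorem lintegral_graphPt_le (F : G → ℝ≥0∞) (s : D) :
    ∫⁻ z, F (graphPt s z) ∂leb ≤ ∫⁻ p, F p ∂rcm := by
  rw [lintegral_rcm]
  exact ENNReal.le_tsum s

/-- The columns of the symbol of `B` are square summable, with sum at most `‖B‖ ^ 2`. -/
theorem tsum_column_le {B : K →L[ℂ] K} (hB : ∀ w ∈ rightOps, Commute B w) :
    ∀ᵐ z ∂leb, ∑' s, ‖(B dyadicFeldmanMoore.χΔ : K) (graphPt s z)‖ₑ ^ 2 ≤ ‖B‖ₑ ^ 2 := by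
  classical
  set b := B dyadicFeldmanMoore.χΔ
  have hbm (s : D) : Measurable fun z => ‖b (graphPt s z)‖ₑ ^ 2 :=
    ((Lp.stronglyMeasurable b).measurable.comp (measurable_graphPt s)).enorm.pow_const 2
  refine ae_le_of_forall_setLIntegral_le_of_sigmaFinite (Measurable.tsum hbm) fun A hA _ => ?_
  have hφ := BddMeasurable.indicator_one hA
  obtain ⟨w, hw⟩ := exists_isWeightedComp (hφ.comp measurable_snd)
    (measurePreserving_translateRight 0)
  -- Here `w` restricts z to `A`, so ‖B(w χ_Δ)‖ ≤ ‖B‖ ‖w χ_Δ‖ becomes the column bound integrated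
  -- over `A`.
  have h0 : B (w dyadicFeldmanMoore.χΔ) = w b :=
    DFunLike.congr_fun (hB w ⟨_, hφ, 0, hw⟩).eq _
  have h1 : ‖w b‖ₑ ^ 2 = ∫⁻ z in A, ∑' s, ‖b (graphPt s z)‖ₑ ^ 2 ∂leb := by
    rw [enorm_sq_eq_lintegral, lintegral_rcm, lintegral_tsum fun s => (hbm s).aemeasurable]
    refine tsum_congr fun s => ?_
    rw [← lintegral_indicator hA]
    refine lintegral_congr_ae ?_
    filter_upwards [ae_rcm_iff.1 (hw b) s] with z hz
    have : translateRight 0 (graphPt s z) = graphPt s z :=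
      Subtype.ext (Prod.ext rfl (by simp [translateRight, graphPt]))
    rw [hz, this]
    change ‖A.indicator 1 z * _‖ₑ ^ 2 = _
    by_cases hzA : z ∈ A <;> simp [hzA]
  have h2 : ‖w dyadicFeldmanMoore.χΔ‖ₑ ^ 2 = leb A := by
    rw [enorm_sq_eq_lintegral, lintegral_rcm, tsum_eq_single 0, ← lintegral_indicator_one hA]
    · refine lintegral_congr_ae ?_
      filter_upwards [ae_rcm_iff.1 (right_apply_χΔ hw) 0] with z hz
      rw [hz, diff_graphPt, if_pos rfl]
      change ‖A.indicator (1 : I → ℂ) z‖ₑ ^ 2 = _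
      by_cases hzA : z ∈ A <;> simp [hzA]
    · intro s hs
      rw [← lintegral_zero (μ := leb)]
      refine lintegral_congr_ae ?_
      filter_upwards [ae_rcm_iff.1 (right_apply_χΔ hw) s] with z hz
      rw [hz, diff_graphPt, if_neg hs]
      simp
  rw [← h1, ← h0, setLIntegral_const, ← h2, ← mul_pow]
  gcongr
  exact ContinuousLinearMap.le_opENorm _ _

theorem enorm_symbol_le {B : K →L[ℂ] K} (hB : ∀ w ∈ rightOps, Commute B w) :
    ∀ᵐ p ∂rcm, ‖(B dyadicFeldmanMoore.χΔ : K) p‖ₑ ≤ ‖B‖ₑ := by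
  filter_upwards [ae_rcm_of_ae_snd (tsum_column_le hB)] with p hp
  refine (ENNReal.pow_le_pow_left_iff two_ne_zero).1 (le_trans ?_ hp)
  have := ENNReal.le_tsum (f := fun s => ‖(B dyadicFeldmanMoore.χΔ : K) (graphPt s p.1.2)‖ₑ ^ 2)
    (diff p)
  simpa only [graphPt_diff] using this

/-- The symbol of `B` has an everywhere bounded representative with small columns. -/
theorem exists_bddMeasurable_symbol {B : K →L[ℂ] K} (hB : ∀ w ∈ rightOps, Commute B w) :
    ∃ β : G → ℂ, BddMeasurable β ∧ (B dyadicFeldmanMoore.χΔ : G → ℂ) =ᵐ[rcm] β ∧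
      ∀ᵐ z ∂leb, ∑' s, ‖β (graphPt s z)‖ₑ ^ 2 ≤ ‖B‖ₑ ^ 2 := by
  set b := B dyadicFeldmanMoore.χΔ
  have hbm : Measurable b := (Lp.stronglyMeasurable b).measurable
  have hS : MeasurableSet {p | ‖b p‖ ≤ ‖B‖} := measurableSet_le hbm.norm measurable_const
  -- Truncating at ‖B‖ changes `b` only on a null set and can only shrink columns.
  refine ⟨{p | ‖b p‖ ≤ ‖B‖}.indicator b, ⟨hbm.indicator hS, ‖B‖, fun p => ?_⟩, ?_, ?_⟩
  · by_cases hp : p ∈ {p | ‖b p‖ ≤ ‖B‖}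
    · rw [Set.indicator_of_mem hp]
      exact hp
    · rw [Set.indicator_of_notMem hp, norm_zero]
      exact norm_nonneg B
  · filter_upwards [enorm_symbol_le hB] with p hp
    rw [Set.indicator_of_mem]
    exact enorm_le_iff_norm_le.1 hp
  · filter_upwards [tsum_column_le hB] with z hz
    refine le_trans (ENNReal.tsum_le_tsum fun s => ?_) hz
    gcongr
    exact enorm_indicator_le_enorm_self _ _

theorem rotate_eq_graphPt (r : D) (p : G) : rotate r p = graphPt (r - diff p) p.1.1 := by
  refine Subtype.ext (Prod.ext ?_ rfl)
  change T r p.1.2 = T (r - diff p : D) p.1.1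
  rw [fst_eq_T p, ← T_add]
  simp

theorem rotate_translateRight (r c : D) (p : G) :
    rotate (r - c) (translateRight c p) = rotate r p := by
  refine Subtype.ext (Prod.ext ?_ rfl)
  change T (r - c : D) (T c p.1.2) = T r p.1.2
  rw [← T_add]
  simp

/-- For p = (y, z), the points (z+r, y) run once through column y as r runs through `D`. -/
theorem tsum_enorm_rotate (β : G → ℂ) (p : G) :
    ∑' r, ‖β (rotate r p)‖ₑ ^ 2 = ∑' s, ‖β (graphPt s p.1.1)‖ₑ ^ 2 := by
  simp_rw [rotate_eq_graphPt]
  exact (Equiv.subRight (diff p)).tsum_eq fun s => ‖β (graphPt s p.1.1)‖ₑ ^ 2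

theorem measurable_diff_piecewise {F : D → G → ℂ} (hF : ∀ r, Measurable (F r)) :
    Measurable fun p => F (diff p) p := by
  intro U hU
  have : (fun p => F (diff p) p) ⁻¹' U = ⋃ r, {p | diff p = r} ∩ F r ⁻¹' U := by
    ext p
    simp
  rw [this]
  exact MeasurableSet.iUnion fun r => (measurableSet_diff_eq r).inter (hF r hU)

/-- The main norm estimate: only the column bound for β is used, together with the operator norm of
`A`. -/
theorem lintegral_schur_le (A : K →L[ℂ] K) {β : G → ℂ} {C : ℝ≥0∞} (hβ : Measurable β)
    (hC : ∀ᵐ z ∂leb, ∑' s, ‖β (graphPt s z)‖ₑ ^ 2 ≤ C ^ 2) {M : D → K →L[ℂ] K}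
    (hM : ∀ r, IsWeightedComp (M r) (fun p => β (rotate r p)) id) (ξ : K) :
    ∫⁻ p, ‖A (M (diff p) ξ) p‖ₑ ^ 2 ∂rcm ≤ (‖A‖ₑ * C * ‖ξ‖ₑ) ^ 2 := by
  have hm (r : D) : Measurable fun p => ‖β (rotate r p)‖ₑ ^ 2 * ‖ξ p‖ₑ ^ 2 :=
    ((hβ.comp (measurePreserving_rotate r).measurable).enorm.pow_const 2).mul
      ((Lp.stronglyMeasurable ξ).measurable.enorm.pow_const 2)
  calc ∫⁻ p, ‖A (M (diff p) ξ) p‖ₑ ^ 2 ∂rcm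
      = ∑' r, ∫⁻ z, ‖A (M r ξ) (graphPt r z)‖ₑ ^ 2 ∂leb := by
        rw [lintegral_rcm]
        simp_rw [diff_graphPt]
    _ ≤ ∑' r, ‖A‖ₑ ^ 2 * ∫⁻ p, ‖β (rotate r p)‖ₑ ^ 2 * ‖ξ p‖ₑ ^ 2 ∂rcm := by
        refine ENNReal.tsum_le_tsum fun r => ?_
        -- Enlarging one graph to the whole relation turns the r-th term into the square of a full
        -- L² norm.
        refine (lintegral_graphPt_le (fun p => ‖A (M r ξ) p‖ₑ ^ 2) r).trans ?_
        rw [← enorm_sq_eq_lintegral]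
        have : ‖M r ξ‖ₑ ^ 2 = ∫⁻ p, ‖β (rotate r p)‖ₑ ^ 2 * ‖ξ p‖ₑ ^ 2 ∂rcm := by
          rw [enorm_sq_eq_lintegral]
          refine lintegral_congr_ae ?_
          filter_upwards [hM r ξ] with p hp
          rw [hp, enorm_mul, mul_pow, id]
        rw [← this, ← mul_pow]
        gcongr
        exact ContinuousLinearMap.le_opENorm _ _
    _ = ‖A‖ₑ ^ 2 * ∫⁻ p, (∑' r, ‖β (rotate r p)‖ₑ ^ 2) * ‖ξ p‖ₑ ^ 2 ∂rcm := by
        rw [ENNReal.tsum_mul_left, ← lintegral_tsum fun r => (hm r).aemeasurable]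
        simp_rw [ENNReal.tsum_mul_right]
    _ ≤ ‖A‖ₑ ^ 2 * ∫⁻ p, C ^ 2 * ‖ξ p‖ₑ ^ 2 ∂rcm := by
        gcongr ‖A‖ₑ ^ 2 * ?_
        refine lintegral_mono_ae ?_
        filter_upwards [ae_rcm_of_ae_fst hC] with p hp
        rw [tsum_enorm_rotate]
        gcongr
    _ = (‖A‖ₑ * C * ‖ξ‖ₑ) ^ 2 := by
        rw [lintegral_const_mul _ ((Lp.stronglyMeasurable ξ).measurable.enorm.pow_const 2),
          ← enorm_sq_eq_lintegral]
        ring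

/-- The Schur product of the operator `A` with the function `β`, whose columns are bounded in
`ℓ²`. -/
theorem exists_schur (A : K →L[ℂ] K) {β : G → ℂ} {C : ℝ≥0} (hβ : Measurable β)
    (hC : ∀ᵐ z ∂leb, ∑' s, ‖β (graphPt s z)‖ₑ ^ 2 ≤ (C : ℝ≥0∞) ^ 2) {M : D → K →L[ℂ] K}
    (hM : ∀ r, IsWeightedComp (M r) (fun p => β (rotate r p)) id) :
    ∃ S : K →L[ℂ] K, ‖S‖ ≤ ‖A‖ * C ∧
      ∀ ξ, (S ξ : G → ℂ) =ᵐ[rcm] fun p => A (M (diff p) ξ) p := by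
  have hmeas (ξ : K) : Measurable fun p => A (M (diff p) ξ) p :=
    measurable_diff_piecewise (F := fun r => A (M r ξ)) fun r =>
      (Lp.stronglyMeasurable _).measurable
  have hle (ξ : K) : eLpNorm (fun p => A (M (diff p) ξ) p) 2 rcm ≤ ‖A‖ₑ * C * ‖ξ‖ₑ := by
    refine (ENNReal.pow_le_pow_left_iff two_ne_zero).1 ?_
    refine le_trans (le_of_eq ?_) (lintegral_schur_le A hβ hC hM ξ)
    have := eLpNorm_nnreal_pow_eq_lintegral (μ := rcm) (f := fun p => A (M (diff p) ξ) p)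
      (p := 2) two_ne_zero
    simpa using this
  have hmem (ξ : K) : MemLp (fun p => A (M (diff p) ξ) p) 2 rcm :=
    ⟨(hmeas ξ).aestronglyMeasurable, (hle ξ).trans_lt
      (ENNReal.mul_lt_top (ENNReal.mul_lt_top enorm_lt_top ENNReal.coe_lt_top) enorm_lt_top)⟩
  let S₀ : K →ₗ[ℂ] K :=
    { toFun := fun ξ => (hmem ξ).toLp
      map_add' := fun ξ η => Lp.ext (by
        -- The index `diff p` varies with p, so one null set must serve all r; countability of `D`
        -- supplies it.
        have h : ∀ᵐ p ∂rcm, ∀ r, A (M r (ξ + η)) p = A (M r ξ) p + A (M r η) p :=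
          ae_all_iff.2 fun r => by
            simp_rw [map_add]
            exact Lp.coeFn_add _ _
        filter_upwards [(hmem (ξ + η)).coeFn_toLp, (hmem ξ).coeFn_toLp, (hmem η).coeFn_toLp,
          Lp.coeFn_add (hmem ξ).toLp (hmem η).toLp, h] with p h1 h2 h3 h4 h5
        rw [h1, h4, Pi.add_apply, h2, h3, h5])
      map_smul' := fun c ξ => Lp.ext (by
        have h : ∀ᵐ p ∂rcm, ∀ r, A (M r (c • ξ)) p = c • A (M r ξ) p :=
          ae_all_iff.2 fun r => by
            simp_rw [map_smul]
            exact Lp.coeFn_smul _ _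
        filter_upwards [(hmem (c • ξ)).coeFn_toLp, (hmem ξ).coeFn_toLp,
          Lp.coeFn_smul c (hmem ξ).toLp, h] with p h1 h2 h3 h4
        rw [h1, RingHom.id_apply, h3, Pi.smul_apply, h2, h4]) }
  have hb (ξ : K) : ‖S₀ ξ‖ ≤ ‖A‖ * C * ‖ξ‖ := by
    have h : ‖S₀ ξ‖ₑ ≤ ‖A‖ₑ * C * ‖ξ‖ₑ := by
      rw [Lp.enorm_def]
      exact (eLpNorm_congr_ae (hmem ξ).coeFn_toLp).trans_le (hle ξ)
    simp only [enorm_eq_nnnorm] at h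
    exact_mod_cast h
  exact ⟨S₀.mkContinuous _ hb, S₀.mkContinuous_norm_le (by positivity) hb,
    fun ξ => (hmem ξ).coeFn_toLp⟩

/-- Shifting z by c and lowering r by c leaves x = z + r fixed; hence w M_{r−c} = M_r w, and `A`
commutes with `w`. -/
theorem commute_schur {A S : K →L[ℂ] K} (hA : ∀ w ∈ rightOps, Commute A w) {β : G → ℂ}
    {M : D → K →L[ℂ] K} (hM : ∀ r, IsWeightedComp (M r) (fun p => β (rotate r p)) id)
    (hS : ∀ ξ, (S ξ : G → ℂ) =ᵐ[rcm] fun p => A (M (diff p) ξ) p) :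
    ∀ w ∈ rightOps, Commute S w := by
  intro w hw
  obtain ⟨φ, hφ, c, h⟩ := id hw
  have hwM (r : D) (ξ : K) : w (M (r - c) ξ) = M r (w ξ) := by
    refine Lp.ext ?_
    filter_upwards [h (M (r - c) ξ), hM r (w ξ), h ξ,
      (measurePreserving_translateRight c).quasiMeasurePreserving.ae (hM (r - c) ξ)]
      with p h1 h2 h3 h4
    rw [h1, h2, h4, id, id, h3, rotate_translateRight, mul_left_comm]
  have hAw (r : D) (ξ : K) : w (A (M (r - c) ξ)) = A (M r (w ξ)) := by
    rw [← hwM]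
    exact (DFunLike.congr_fun (hA w hw).eq (M (r - c) ξ)).symm
  refine ContinuousLinearMap.ext fun ξ => Lp.ext ?_
  have h4 : ∀ᵐ p ∂rcm, ∀ r : D, w (A (M (r - c) ξ)) p =
      φ p.1.2 * A (M (r - c) ξ) (translateRight c p) :=
    ae_all_iff.2 fun r => h (A (M (r - c) ξ))
  filter_upwards [hS (w ξ), h (S ξ),
    (measurePreserving_translateRight c).quasiMeasurePreserving.ae (hS ξ), h4] with p h1 h2 h3 h4
  refine h1.trans (Eq.trans ?_ h2.symm)
  rw [h3, ← hAw, h4, diff_translateRight]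

/-- On the diagonal the weight of `M` is β(z+r, z), a function of z alone. So `M` may be replaced
there by a right multiplication, which commutes with `A`. -/
theorem apply_rotate_χΔ {A M : K →L[ℂ] K} (hA : ∀ w ∈ rightOps, Commute A w) {β : G → ℂ}
    (hβ : BddMeasurable β) {r : D} (hM : IsWeightedComp M (fun p => β (rotate r p)) id) :
    (A (M dyadicFeldmanMoore.χΔ) : G → ℂ) =ᵐ[rcm]
      fun p => β (graphPt r p.1.2) * A dyadicFeldmanMoore.χΔ p := by
  classical
  have hφ : BddMeasurable fun z => β (graphPt r z) := hβ.comp (measurable_graphPt r)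
  obtain ⟨N, hN⟩ := exists_isWeightedComp (hφ.comp measurable_snd)
    (measurePreserving_translateRight 0)
  have h1 : M dyadicFeldmanMoore.χΔ = N dyadicFeldmanMoore.χΔ := by
    refine Lp.ext ?_
    filter_upwards [hM dyadicFeldmanMoore.χΔ,
      right_apply_χΔ (φ := fun z => β (graphPt r z)) hN, coeFn_χΔ] with p h1 h2 h3
    rw [h1, h2, id, h3]
    split_ifs with hp
    · have : rotate r p = graphPt r p.1.2 := by
        rw [rotate_eq_graphPt, fst_eq_T p, hp]
        simp
      rw [this, mul_one]
    · rw [mul_zero]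
  have h2 : A (N dyadicFeldmanMoore.χΔ) = N (A dyadicFeldmanMoore.χΔ) :=
    DFunLike.congr_fun (hA N ⟨_, hφ, 0, hN⟩).eq _
  rw [h1, h2]
  filter_upwards [hN (A dyadicFeldmanMoore.χΔ)] with p hp
  have : translateRight 0 p = p := Subtype.ext (Prod.ext rfl (by simp [translateRight]))
  rw [hp, this]

theorem exists_schur_product {A B : K →L[ℂ] K} (hA : ∀ w ∈ rightOps, Commute A w)
    (hB : ∀ w ∈ rightOps, Commute B w) :
    ∃ S : K →L[ℂ] K, (∀ w ∈ rightOps, Commute S w) ∧ ‖S‖ ≤ ‖A‖ * ‖B‖ ∧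
      (S dyadicFeldmanMoore.χΔ : G → ℂ) =ᵐ[rcm]
        (A dyadicFeldmanMoore.χΔ : G → ℂ) * (B dyadicFeldmanMoore.χΔ : G → ℂ) := by
  obtain ⟨β, hβ, hbβ, hcol⟩ := exists_bddMeasurable_symbol hB
  choose M hM using fun r : D => exists_isWeightedComp
    (hβ.comp (measurePreserving_rotate r).measurable) (MeasurePreserving.id rcm)
  obtain ⟨S, hSn, hS⟩ := exists_schur A (C := ‖B‖₊) hβ.1 hcol hM
  refine ⟨S, commute_schur hA hM hS, hSn, ?_⟩
  -- At p the relevant index is r = `diff p`, and then (z+r, z) is p itself.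
  filter_upwards [hS dyadicFeldmanMoore.χΔ, ae_all_iff.2 fun r => apply_rotate_χΔ hA hβ (hM r),
    hbβ] with p h1 h2 h3
  rw [h1, h2, graphPt_diff, Pi.mul_apply, h3, mul_comm]

theorem symbolSet_subset_Lp_top {a : G →ₘ[rcm] ℂ} (ha : a ∈ dyadicFeldmanMoore.symbolSet) :
    a ∈ Lp ℂ ∞ rcm := by
  obtain ⟨A, rfl⟩ := ha
  rw [Lp.mem_Lp_iff_memLp]
  refine memLp_top_of_bound (AEEqFun.aestronglyMeasurable _) ‖(A : K →L[ℂ] K)‖ ?_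
  filter_upwards [enorm_symbol_le ((mem_vN_iff _).1 A.2)] with p hp
  exact enorm_le_iff_norm_le.1 hp

/-- The pointwise product of the symbols of `A` and `B` is the symbol of an operator of norm at
most `‖A‖ * ‖B‖`. -/
theorem exists_symbol_eq_mul (A B : dyadicFeldmanMoore.vN) :
    ∃ S : dyadicFeldmanMoore.vN, ‖(S : K →L[ℂ] K)‖ ≤ ‖(A : K →L[ℂ] K)‖ * ‖(B : K →L[ℂ] K)‖ ∧
      dyadicFeldmanMoore.symbol S = dyadicFeldmanMoore.symbol A * dyadicFeldmanMoore.symbol B := by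
  obtain ⟨S, hS, hn, h⟩ := exists_schur_product ((mem_vN_iff _).1 A.2) ((mem_vN_iff _).1 B.2)
  exact ⟨⟨S, (mem_vN_iff S).2 hS⟩, hn, AEEqFun.ext (h.trans (AEEqFun.coeFn_mul _ _).symm)⟩

end

end DyadicRelation

open DyadicRelation in
theorem theorem6p4 :
    dyadicFeldmanMoore.symbolSet ⊆ dyadicFeldmanMoore.schurMultipliers ∧
    ∀ (a b : dyadicFeldmanMoore.Graph →ₘ[dyadicFeldmanMoore.ν] ℂ)
      (ha : a ∈ dyadicFeldmanMoore.symbolSet) (hb : b ∈ dyadicFeldmanMoore.symbolSet),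
      ∃ hab : a * b ∈ dyadicFeldmanMoore.symbolSet,
        ‖(dyadicFeldmanMoore.inverseSymbol ⟨a * b, hab⟩ :
            dyadicFeldmanMoore.H →L[ℂ] dyadicFeldmanMoore.H)‖ ≤
          ‖(dyadicFeldmanMoore.inverseSymbol ⟨a, ha⟩ :
            dyadicFeldmanMoore.H →L[ℂ] dyadicFeldmanMoore.H)‖ *
          ‖(dyadicFeldmanMoore.inverseSymbol ⟨b, hb⟩ :
            dyadicFeldmanMoore.H →L[ℂ] dyadicFeldmanMoore.H)‖ := by
  have key : ∀ (a b : dyadicFeldmanMoore.Graph →ₘ[dyadicFeldmanMoore.ν] ℂ)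
      (ha : a ∈ dyadicFeldmanMoore.symbolSet) (hb : b ∈ dyadicFeldmanMoore.symbolSet),
      ∃ hab : a * b ∈ dyadicFeldmanMoore.symbolSet,
        ‖(dyadicFeldmanMoore.inverseSymbol ⟨a * b, hab⟩ : K →L[ℂ] K)‖ ≤
          ‖(dyadicFeldmanMoore.inverseSymbol ⟨a, ha⟩ : K →L[ℂ] K)‖ *
          ‖(dyadicFeldmanMoore.inverseSymbol ⟨b, hb⟩ : K →L[ℂ] K)‖ := by
    intro a b ha hb
    obtain ⟨S, hS, h⟩ := exists_symbol_eq_mul (dyadicFeldmanMoore.inverseSymbol ⟨a, ha⟩)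
      (dyadicFeldmanMoore.inverseSymbol ⟨b, hb⟩)
    rw [symbol_inverseSymbol, symbol_inverseSymbol] at h
    have hab : a * b ∈ dyadicFeldmanMoore.symbolSet := ⟨S, h⟩
    -- Injectivity of the symbol map identifies the chosen preimage with the operator whose norm was
    -- bounded.
    have hinv : dyadicFeldmanMoore.inverseSymbol ⟨a * b, hab⟩ = S :=
      symbol_injective ((symbol_inverseSymbol _).trans h.symm)
    exact ⟨hab, hinv ▸ hS⟩
  exact ⟨fun a ha => ⟨symbolSet_subset_Lp_top ha, fun b hb => (key a b ha hb).1⟩, key⟩
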